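/- Let $K$ be a finite simplicial complex of dimension at most $d$ (the lattice) and $A\subseteq K$ a subcomplex (the region). Let $\partial A$ be its entangling surface: the subcomplex of all simplices of $A$ that are a face of some simplex of $K$ not in $A$. Write $K_{n,\partial A}$ for the set of $n$-simplices of $\partial A$, $C_A$ and $C_{\partial A}$ for the integral simplicial chain complexes of $A$ and $\partial A$, and $\beta_n$ for the $n$-th Betti number (the rank of the $n$-th integral homology group). For an Abelian higher gauge theory given by a chain complex $(G,\partial^G)$ of finite Abelian groups, the area term and the topological term of the entanglement entropy of $A$ are $$S_{\partial A}=\sum_{n=0}^{d-1}\sum_{p=1}^{d}(-1)^{p+1}\,|K_{n,\partial A}|\,\log|G_{n+p}|,$$ $$S_{\mathrm{Topo}}=\sum_{n=0}^{d}\log\bigl|H^n(C_A,H_n(G))\bigr|+\sum_{n=0}^{d-1}\sum_{p=1}^{d}(-1)^p\log\bigl|H^n(C_{\partial A},H_{n+p}(G))\bigr|.$$ Consider the $d$-dimensional Abelian 1-gauge theory (Abelian quantum double model), i.e. the case in which $G_1$ is a finite Abelian group and $G_n=0$ for all $n\neq 1$. Then $$S_{\partial A}=|K_{0,\partial A}|\,\log|G_1|,\qquad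 S_{\mathrm{Topo}}=\log\bigl|\mathrm{Hom}(H_1(C_A),G_1)\bigr|-\beta_0(\partial A)\,\log|G_1|.$$ In particular, if (the geometric realization of) $A$ is homeomorphic to the $d$-torus $T^d=(S^1)^d$, then $\beta_1(A)=d$ and $$S_{\mathrm{Topo}}=\bigl(\beta_1(A)-\beta_0(\partial A)\bigr)\log|G_1|.$$ -/

import Mathlib

open CategoryTheory

universe u v

namespace GaugeEntropy

section Simplicial

variable {V : Type v}

/-- The set `K_n` of `n`-simplices of `K`, i.e. of faces with `n + 1` vertices. -/
abbrev Simplices (K : PreAbstractSimplicialComplex V) (n : ℕ) : Type v :=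
  {s : Finset V // s ∈ K ∧ s.card = n + 1}

/-- The geometric realization `|K|`, in barycentric coordinates, as a subspace of `V → ℝ`
(the vertex set is finite). -/
def realization [Fintype V] (K : PreAbstractSimplicialComplex V) : Set (V → ℝ) :=
  {x | (∀ v, 0 ≤ x v) ∧ ∑ v, x v = 1 ∧ ∃ s ∈ K, ∀ v, v ∉ s → x v = 0}

/-- The entangling surface `∂A` of a region `A` in the lattice `K`: the simplices of `A` that are
a face of some simplex of `K` outside `A`. In the geometric realization this is the
triangulation of the topological frontier of `|A|` in `|K|`; its complement in `A` is the interior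
of `A`. -/
def entanglingSurface (K A : PreAbstractSimplicialComplex V) : PreAbstractSimplicialComplex V where
  faces := {s | s ∈ A ∧ ∃ t ∈ K, t ∉ A ∧ s ⊆ t}
  isRelLowerSet_faces := by
    rintro s ⟨hs, t, ht, htA, hst⟩
    refine ⟨(A.isRelLowerSet_faces hs).1, fun r hr hne => ?_⟩
    exact ⟨(A.isRelLowerSet_faces hs).2 hr hne, t, ht, htA, fun x hx => hst (hr hx)⟩

variable [LinearOrder V]

/-- The face of an `(n+1)`-simplex opposite to its vertex `v`. -/
def oppositeFace {K : PreAbstractSimplicialComplex V} {n : ℕ} (s : Simplices K (n + 1))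
    (v : {x // x ∈ s.1}) : Simplices K n :=
  ⟨s.1.erase v.1, by
    have hc : (s.1.erase v.1).card = n + 1 := by
      rw [Finset.card_erase_of_mem v.2, s.2.2]; rfl
    refine ⟨(K.isRelLowerSet_faces s.2.1).2 (Finset.erase_subset _ _) ?_, hc⟩
    exact Finset.card_pos.mp (by omega)⟩

/-- `(-1)^i`, where `v` is the `i`-th vertex (counted from `0`) of `s`. -/
def faceSign (s : Finset V) (v : V) : ℤ := (-1) ^ (s.filter (· < v)).card

/-- The simplicial boundary map `∂ₙ₊₁ : Cₙ₊₁(K) → Cₙ(K)`,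
`[v₀, …, vₙ₊₁] ↦ ∑ᵢ (-1)^i [v₀, …, v̂ᵢ, …, vₙ₊₁]` for `v₀ < ⋯ < vₙ₊₁`. -/
noncomputable def boundary (K : PreAbstractSimplicialComplex V) (n : ℕ) :
    (Simplices K (n + 1) →₀ ℤ) →+ (Simplices K n →₀ ℤ) :=
  Finsupp.liftAddHom fun s => zmultiplesHom _
    (∑ v : {x // x ∈ s.1}, faceSign s.1 v.1 • Finsupp.single (oppositeFace s v) (1 : ℤ))

theorem boundary_single (K : PreAbstractSimplicialComplex V) (n : ℕ) (s : Simplices K (n + 1)) :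
    boundary K n (Finsupp.single s 1) =
      ∑ v : {x // x ∈ s.1}, faceSign s.1 v.1 • Finsupp.single (oppositeFace s v) (1 : ℤ) := by
  simp [boundary]

theorem faceSign_swap (s : Finset V) {v w : V} (hv : v ∈ s) (h : v < w) :
    faceSign s v * faceSign (s.erase v) w + faceSign s w * faceSign (s.erase w) v = 0 := by
  have h1 : (s.erase w).filter (· < v) = s.filter (· < v) := by
    ext x
    simp only [Finset.mem_filter, Finset.mem_erase]
    exact ⟨fun hx => ⟨hx.1.2, hx.2⟩, fun hx => ⟨⟨(hx.2.trans h).ne, hx.1⟩, hx.2⟩⟩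
  have h2 : (s.erase v).filter (· < w) = (s.filter (· < w)).erase v := by
    ext x
    simp only [Finset.mem_filter, Finset.mem_erase, and_assoc]
  have h3 : v ∈ s.filter (· < w) := Finset.mem_filter.mpr ⟨hv, h⟩
  have h4 : (s.filter (· < w)).card = ((s.erase v).filter (· < w)).card + 1 := by
    rw [h2, Finset.card_erase_add_one h3]
  unfold faceSign
  rw [h1, h4, pow_succ]
  ring

theorem boundary_comp_boundary (K : PreAbstractSimplicialComplex V) (n : ℕ) :
    (boundary K n).comp (boundary K (n + 1)) = 0 := by
  refine Finsupp.addHom_ext' fun s => AddMonoidHom.ext_int ?_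
  simp only [AddMonoidHom.comp_apply, Finsupp.singleAddHom_apply, AddMonoidHom.zero_apply]
  rw [boundary_single, map_sum]
  simp only [map_zsmul, boundary_single, Finset.smul_sum, smul_smul]
  rw [Finset.sum_sigma']
  refine Finset.sum_involution
    (fun a _ => ⟨⟨a.2.1, (Finset.mem_erase.mp a.2.2).2⟩,
      ⟨a.1.1, Finset.mem_erase.mpr ⟨(Finset.mem_erase.mp a.2.2).1.symm, a.1.2⟩⟩⟩)
    ?_ ?_ ?_ ?_
  · rintro ⟨⟨v, hv⟩, ⟨w, hw⟩⟩ _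
    obtain ⟨hne, hw'⟩ := Finset.mem_erase.mp hw
    have hface : oppositeFace (oppositeFace s ⟨v, hv⟩) ⟨w, hw⟩ =
        oppositeFace (oppositeFace s ⟨w, hw'⟩) ⟨v, Finset.mem_erase.mpr ⟨hne.symm, hv⟩⟩ :=
      Subtype.ext Finset.erase_right_comm
    rw [hface, ← add_smul]
    have : faceSign s.1 v * faceSign (s.1.erase v) w
        + faceSign s.1 w * faceSign (s.1.erase w) v = 0 := by
      rcases lt_or_gt_of_ne hne with h | h
      · rw [add_comm]; exact faceSign_swap s.1 hw' h
      · exact faceSign_swap s.1 hv h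
    change (faceSign s.1 v * faceSign (s.1.erase v) w
        + faceSign s.1 w * faceSign (s.1.erase w) v) • _ = _
    rw [this, zero_smul]
  · rintro ⟨⟨v, hv⟩, ⟨w, hw⟩⟩ _ _ h
    have h1 : w = v := congrArg (fun a => a.1.1) h
    exact (Finset.mem_erase.mp hw).1 h1
  · intros; exact Finset.mem_univ _
  · intros; rfl

/-- The simplicial chain complex `C(K)`: `Cₙ(K)` is the free abelian group on the `n`-simplices. -/
noncomputable def chains (K : PreAbstractSimplicialComplex V) : ChainComplex AddCommGrpCat.{v} ℕ :=
  ChainComplex.of (fun n => AddCommGrpCat.of (Simplices K n →₀ ℤ))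
    (fun n => AddCommGrpCat.ofHom (boundary K n))
    (fun n => by
      rw [← AddCommGrpCat.ofHom_comp, boundary_comp_boundary]
      rfl)

end Simplicial

section Coefficients

/-- `n`-cocycles of `C` with values in `D`: homomorphisms `f : Cₙ → D` with `f ∘ ∂ₙ₊₁ = 0`. -/
def cocycles (C : ChainComplex AddCommGrpCat.{v} ℕ) (D : Type u) [AddCommGroup D] (n : ℕ) :
    AddSubgroup (C.X n →+ D) :=
  (AddMonoidHom.compHom' (P := D) (C.d (n + 1) n).hom).ker

/-- `n`-coboundaries of `C` with values in `D`: homomorphisms of the form `g ∘ ∂ₙ` with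
`g : Cₙ₋₁ → D`. For `n = 0` the differential `C.d 0 (0 - 1) = C.d 0 0` is zero, so that only the
zero homomorphism is a `0`-coboundary. -/
def coboundaries (C : ChainComplex AddCommGrpCat.{v} ℕ) (D : Type u) [AddCommGroup D] (n : ℕ) :
    AddSubgroup (C.X n →+ D) :=
  (AddMonoidHom.compHom' (P := D) (C.d n (n - 1)).hom).range

/-- The cohomology group `Hⁿ(C, D)` with coefficients in `D`. -/
abbrev Cohomology (C : ChainComplex AddCommGrpCat.{v} ℕ) (D : Type u) [AddCommGroup D] (n : ℕ) :
    Type (max u v) :=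
  cocycles C D n ⧸ (coboundaries C D n).addSubgroupOf (cocycles C D n)

/-- The `n`-th Betti number of `C`: the rank of the integral homology group `Hₙ(C)`. -/
noncomputable def betti (C : ChainComplex AddCommGrpCat.{v} ℕ) (n : ℕ) : ℕ :=
  Module.finrank ℤ (C.homology n)

end Coefficients

section Entropy

variable {V : Type v} [LinearOrder V]

/-- The area term of the entanglement entropy of the region `A` of the `d`-dimensional lattice `K`,
for the Abelian higher gauge theory with chain complex of gauge groups `G`:
`S_∂A = ∑_{n=0}^{d-1} ∑_{p=1}^{d} (-1)^{p+1} |K_{n,∂A}| log |G_{n+p}|`. -/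
noncomputable def areaTerm (d : ℕ) (K A : PreAbstractSimplicialComplex V)
    (G : ChainComplex AddCommGrpCat.{u} ℕ) : ℝ :=
  ∑ n ∈ Finset.range d, ∑ p ∈ Finset.Icc 1 d,
    (-1 : ℝ) ^ (p + 1) * (Nat.card (Simplices (entanglingSurface K A) n) : ℝ)
      * Real.log (Nat.card (G.X (n + p)))

/-- The topological term of the entanglement entropy of the region `A` of the `d`-dimensional
lattice `K`, for the Abelian higher gauge theory with chain complex of gauge groups `G`:
`S_Topo = ∑_{n=0}^{d} log |Hⁿ(C_A, Hₙ(G))|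
  + ∑_{n=0}^{d-1} ∑_{p=1}^{d} (-1)^p log |Hⁿ(C_∂A, H_{n+p}(G))|`. -/
noncomputable def topologicalTerm (d : ℕ) (K A : PreAbstractSimplicialComplex V)
    (G : ChainComplex AddCommGrpCat.{u} ℕ) : ℝ :=
  ∑ n ∈ Finset.range (d + 1), Real.log (Nat.card (Cohomology (chains A) (G.homology n) n))
    + ∑ n ∈ Finset.range d, ∑ p ∈ Finset.Icc 1 d,
        (-1 : ℝ) ^ p * Real.log (Nat.card
          (Cohomology (chains (entanglingSurface K A)) (G.homology (n + p)) n))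

end Entropy

end GaugeEntropy

/-! Since `G` is concentrated in degree 1, its only possibly nonzero homology is `H₁(G) ≅ G₁`. In
the sums only `n = 1` and `(n, p) = (0, 1)` survive, and two cohomology groups remain: `H¹(C_A, G₁)`
and `H⁰(C_∂A, G₁)`.

In degrees 0 and 1 universal coefficients has no Ext term: the differential `C₁ → C₀` has a
generalized inverse `Γ` with `∂Γ∂ = ∂`, built from chains joining each vertex to a base vertex
(`exists_boundary_generalizedInverse`). Hence `Hⁿ(C, D) ≅ Hom(Hₙ(C), D)` for `n ≤ 1`
(`nonempty_cohomology_chains_equiv`). Moreover `H₀` is free of finite rank, so `|Hom(H₀, D)| = |D| ^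
β₀`.

The torus is only given up to homeomorphism, so `H¹` must be seen to be a topological invariant. It
is identified with a uniform Alexander–Spanier group of the realization
(`nonempty_orderedCohomology_equiv_small`). Homeomorphisms of compact metric spaces preserve this
group, and for the torus it is `D ^ d` by winding numbers (`nonempty_smallCohomology_torus_equiv`).
Taking `D = ℚ` gives `β₁(A) = d`, and `D = G₁` gives `|Hom(H₁(A), G₁)| = |G₁| ^ d`. -/

namespace GaugeEntropy

/-! ### Homology by cycles and boundaries; universal coefficients from a generalized inverse -/

section Homology

theorem exists_surjective_cycles_homology (S : ShortComplex AddCommGrpCat.{v}) :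
    ∃ π : S.g.hom.ker →+ S.homology, Function.Surjective π ∧
      ∀ z, π z = 0 ↔ ∃ x, S.f.hom x = z.1 := by
  let e := S.abHomologyIso.addCommGroupIsoToAddEquiv
  refine ⟨e.symm.toAddMonoidHom.comp (QuotientAddGroup.mk' S.abToCycles.range),
    e.symm.surjective.comp (QuotientAddGroup.mk'_surjective _), fun z => ?_⟩
  refine (map_eq_zero_iff _ e.symm.injective).trans ((QuotientAddGroup.eq_zero_iff _).trans ?_)
  constructor
  · rintro ⟨x, rfl⟩
    exact ⟨x, rfl⟩
  · rintro ⟨x, hx⟩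
    exact ⟨x, Subtype.ext hx⟩

variable (C : ChainComplex AddCommGrpCat.{v} ℕ) (n : ℕ)

/-- Boundaries, as a subgroup of the group of cycles. -/
def boundariesInCycles : AddSubgroup (C.d n (n - 1)).hom.ker :=
  (C.d (n + 1) n).hom.range.addSubgroupOf (C.d n (n - 1)).hom.ker

/-- Homology is the group of cycles modulo boundaries. -/
theorem nonempty_homology_equiv :
    Nonempty (C.homology n ≃+ ((C.d n (n - 1)).hom.ker ⧸ boundariesInCycles C n : Type v)) := by
  -- At `n = 0` both sides are `0`: the complex shape fixes an index without successor, and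
  -- subtraction is truncated.
  have hn : (ComplexShape.down ℕ).next n = n - 1 := by cases n <;> simp
  let S := C.sc' (n + 1) n (n - 1)
  have e1 : C.homology n ≃+ S.homology :=
    (ShortComplex.homologyMapIso (C.isoSc' (n + 1) n (n - 1) (by simp) hn)).addCommGroupIsoToAddEquiv
  obtain ⟨p, hp, hp0⟩ := exists_surjective_cycles_homology S
  let π : (C.d n (n - 1)).hom.ker →+ C.homology n := e1.symm.toAddMonoidHom.comp p
  have hπ : Function.Surjective π := e1.symm.surjective.comp hp
  have hker : π.ker = boundariesInCycles C n := by
    ext z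
    exact (map_eq_zero_iff _ e1.symm.injective).trans (hp0 z)
  exact ⟨((QuotientAddGroup.quotientAddEquivOfEq hker.symm).trans
    (QuotientAddGroup.quotientKerEquivOfSurjective π hπ)).symm⟩

variable {C n}

/-- If the `n`-th differential `∂` of `C` admits a generalized inverse `Γ` (`∂ Γ ∂ = ∂`), then
`Hⁿ(C, D)` is isomorphic to `Hom(Hₙ(C), D)` for every `D`. -/
theorem nonempty_cohomology_equiv (D : Type u) [AddCommGroup D] (Γ : C.X (n - 1) →+ C.X n)
    (hΓ : ∀ x, (C.d n (n - 1)).hom (Γ ((C.d n (n - 1)).hom x)) = (C.d n (n - 1)).hom x) :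
    Nonempty (Cohomology C D n ≃+ (C.homology n →+ D)) := by
  obtain ⟨e⟩ := nonempty_homology_equiv C n
  set Z := (C.d n (n - 1)).hom.ker with hZ
  have hdd (x : C.X (n + 1)) : (C.d n (n - 1)).hom ((C.d (n + 1) n).hom x) = 0 := by
    have := C.d_comp_d (n + 1) n (n - 1)
    exact DFunLike.congr_fun (congrArg AddCommGrpCat.Hom.hom this) x
  have hker (f : cocycles C D n) :
      boundariesInCycles C n ≤ (f.1.comp Z.subtype).ker := by
    rintro z ⟨x, hx⟩
    have h0 : f.1 ((C.d (n + 1) n).hom x) = 0 := DFunLike.congr_fun f.2 x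
    have hx' : (C.d (n + 1) n).hom x = z.1 := hx
    rw [hx'] at h0
    exact h0
  let Φ : cocycles C D n →+ (((C.d n (n - 1)).hom.ker ⧸ boundariesInCycles C n) →+ D) :=
    { toFun := fun f => QuotientAddGroup.lift _ (f.1.comp Z.subtype) (hker f)
      map_zero' := by
        ext z; rfl
      map_add' := fun f g => by
        ext z; rfl }
  have hΦ (f : cocycles C D n) (z : Z) : Φ f (QuotientAddGroup.mk z) = f.1 z.1 := rfl
  have hsurj : Function.Surjective Φ := by
    intro φ
    -- `1 - Γ∂` is a retraction of `Cₙ` onto the cycles, so homomorphisms defined on cycles extend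
    -- to all of `Cₙ`.
    let r : C.X n →+ Z :=
      AddMonoidHom.codRestrict (AddMonoidHom.id _ - Γ.comp (C.d n (n - 1)).hom) Z (fun x => by
        simp [hZ, AddMonoidHom.mem_ker, hΓ])
    have hr (z : Z) : r z.1 = z := by
      apply Subtype.ext
      have : (C.d n (n - 1)).hom z.1 = 0 := z.2
      simp [r, this]
    refine ⟨⟨(φ.comp (QuotientAddGroup.mk' _)).comp r, ?_⟩, ?_⟩
    · refine AddMonoidHom.ext fun x => ?_
      have hx : (C.d (n + 1) n).hom x ∈ Z := hdd x
      change φ (QuotientAddGroup.mk (r ((C.d (n + 1) n).hom x))) = 0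
      rw [show r ((C.d (n + 1) n).hom x) = ⟨_, hx⟩ from hr ⟨_, hx⟩]
      have : (QuotientAddGroup.mk ⟨_, hx⟩ : Z ⧸ boundariesInCycles C n) = 0 :=
        (QuotientAddGroup.eq_zero_iff _).mpr ⟨x, rfl⟩
      exact (congrArg φ this).trans (map_zero φ)
    · ext z
      change φ (QuotientAddGroup.mk (r z.1)) = φ (QuotientAddGroup.mk z)
      rw [hr]
  have hkerΦ : Φ.ker = (coboundaries C D n).addSubgroupOf (cocycles C D n) := by
    ext f
    constructor
    · intro hf
      -- Here `f` vanishes on cycles, in particular on `x - Γ∂x`, so `f = (f ∘ Γ) ∘ ∂`.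
      refine ⟨f.1.comp Γ, ?_⟩
      refine AddMonoidHom.ext fun x => ?_
      have hx : x - Γ ((C.d n (n - 1)).hom x) ∈ Z := by simp [hZ, AddMonoidHom.mem_ker, hΓ]
      have h0 : Φ f (QuotientAddGroup.mk ⟨_, hx⟩) = 0 := by
        rw [AddMonoidHom.mem_ker.mp hf]; rfl
      rw [hΦ, map_sub, sub_eq_zero] at h0
      exact h0.symm
    · rintro ⟨g, hg⟩
      rw [AddMonoidHom.mem_ker]
      ext z
      have hz : (C.d n (n - 1)).hom z.1 = 0 := z.2
      have h1 : f.1 z.1 = g ((C.d n (n - 1)).hom z.1) := DFunLike.congr_fun hg.symm z.1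
      change f.1 z.1 = 0
      rw [h1, hz, map_zero]
  exact ⟨((QuotientAddGroup.quotientAddEquivOfEq hkerΦ.symm).trans
    (QuotientAddGroup.quotientKerEquivOfSurjective Φ hsurj)).trans e.addMonoidHomCongrLeft.symm⟩

/-- If the first differential `∂` of `C` admits a generalized inverse `Γ` (`∂ Γ ∂ = ∂`), then
`H₀(C)` embeds into `C₀`. -/
theorem exists_injective_homology_zero (Γ : C.X 0 →+ C.X 1)
    (hΓ : ∀ x, (C.d 1 0).hom (Γ ((C.d 1 0).hom x)) = (C.d 1 0).hom x) :
    ∃ j : C.homology 0 →+ C.X 0, Function.Injective j := by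
  obtain ⟨e⟩ := nonempty_homology_equiv C 0
  -- `1 - ∂Γ` kills boundaries, and `z = ∂Γz` exhibits any `z` in its kernel as a boundary.
  let p : (C.d 0 (0 - 1)).hom.ker →+ C.X 0 :=
    (AddMonoidHom.id _ - (C.d 1 0).hom.comp Γ).comp (AddSubgroup.subtype _)
  have hp : boundariesInCycles C 0 ≤ p.ker := by
    rintro z ⟨x, hx⟩
    have hx' : (C.d 1 0).hom x = z.1 := hx
    change z.1 - (C.d 1 0).hom (Γ z.1) = 0
    rw [← hx', hΓ, sub_self]
  have hinj : Function.Injective (QuotientAddGroup.lift _ p hp) := by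
    rw [injective_iff_map_eq_zero]
    intro q
    induction q using QuotientAddGroup.induction_on with
    | H z =>
      intro hz
      have hz' : z.1 - (C.d 1 0).hom (Γ z.1) = 0 := hz
      exact (QuotientAddGroup.eq_zero_iff _).mpr ⟨Γ z.1, (sub_eq_zero.mp hz').symm⟩
  exact ⟨(QuotientAddGroup.lift _ p hp).comp e.toAddMonoidHom, hinj.comp e.injective⟩

end Homology

/-! ### Homology of a complex concentrated in degree 1 -/

section Concentrated

variable (G : ChainComplex AddCommGrpCat.{u} ℕ)

theorem subsingleton_homology (n : ℕ) [Subsingleton (G.X n)] : Subsingleton (G.homology n) := by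
  obtain ⟨e⟩ := nonempty_homology_equiv G n
  have : Subsingleton ((G.d n (n - 1)).hom.ker ⧸ boundariesInCycles G n) :=
    (QuotientAddGroup.mk_surjective).subsingleton
  exact e.toEquiv.subsingleton

theorem nonempty_homology_one_equiv (h0 : Subsingleton (G.X 0)) (h2 : Subsingleton (G.X 2)) :
    Nonempty (G.homology 1 ≃+ G.X 1) := by
  obtain ⟨e⟩ := nonempty_homology_equiv G 1
  have hB : boundariesInCycles G 1 = ⊥ := by
    rw [eq_bot_iff]
    rintro z ⟨x, hx⟩
    have hx' : (G.d 2 1).hom x = z.1 := hx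
    have : x = 0 := h2.elim _ _
    rw [this, map_zero] at hx'
    exact Subtype.ext hx'.symm
  have hZ : (G.d 1 (1 - 1)).hom.ker = ⊤ := by
    rw [eq_top_iff]
    intro x _
    exact h0.elim _ _
  exact ⟨e.trans (((QuotientAddGroup.quotientAddEquivOfEq hB).trans
    QuotientAddGroup.quotientBot).trans
    ((AddEquiv.addSubgroupCongr hZ).trans AddSubgroup.topEquiv))⟩

end Concentrated

/-! ### Simplicial chains in low degrees, freeness of H₀, counting homomorphisms -/

section Chains

variable {V : Type v} {K : PreAbstractSimplicialComplex V}

theorem face_mem {s t : Finset V} (ht : t ∈ K) (hst : s ⊆ t) (hs : s.Nonempty) : s ∈ K :=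
  (K.isRelLowerSet_faces ht).2 hst hs

/-- Vertices of `K`, as `0`-simplices. -/
def vertex {v : V} (hK : {v} ∈ K) : Simplices K 0 :=
  ⟨{v}, hK, Finset.card_singleton v⟩

variable [LinearOrder V]

variable (K) in
theorem chains_d (n : ℕ) :
    ((chains K).d (n + 1) n).hom = boundary K n := by
  exact congrArg AddCommGrpCat.Hom.hom (ChainComplex.of_d
    (fun n => AddCommGrpCat.of (Simplices K n →₀ ℤ)) (fun n => AddCommGrpCat.ofHom (boundary K n)) n)

/-- Edges of `K`, as `1`-simplices. -/
def edge {v w : V} (h : v < w) (hK : {v, w} ∈ K) : Simplices K 1 :=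
  ⟨{v, w}, hK, Finset.card_pair h.ne⟩

theorem exists_eq_edge (s : Simplices K 1) :
    ∃ (v w : V) (h : v < w) (hK : {v, w} ∈ K), s = edge h hK := by
  obtain ⟨s, hs, hc⟩ := s
  obtain ⟨v, w, hvw, rfl⟩ := Finset.card_eq_two.mp hc
  rcases lt_or_gt_of_ne hvw with h | h
  · exact ⟨v, w, h, hs, rfl⟩
  · exact ⟨w, v, h, by rwa [Finset.pair_comm], Subtype.ext (Finset.pair_comm v w)⟩

theorem boundary_edge {v w : V} (h : v < w) (hK : {v, w} ∈ K) :
    boundary K 0 (Finsupp.single (edge h hK) 1) =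
      Finsupp.single (vertex (face_mem hK (by simp) (by simp) : {w} ∈ K)) 1 -
        Finsupp.single (vertex (face_mem hK (by simp) (by simp) : {v} ∈ K)) 1 := by
  rw [boundary_single]
  have hu : (Finset.univ : Finset {x // x ∈ (edge h hK).1}) =
      {⟨v, Finset.mem_insert_self _ _⟩, ⟨w, by simp [edge]⟩} := by
    ext ⟨x, hx⟩
    have hx' : x = v ∨ x = w := by simpa [edge] using hx
    simpa [Subtype.ext_iff] using hx'
  have hv : faceSign (edge h hK).1 v = 1 := by
    have : (edge h hK).1.filter (· < v) = ∅ := by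
      ext x
      simp only [edge, Finset.mem_filter, Finset.mem_insert, Finset.mem_singleton]
      grind
    rw [faceSign, this]; simp
  have hw : faceSign (edge h hK).1 w = -1 := by
    have : (edge h hK).1.filter (· < w) = {v} := by
      ext x
      simp only [edge, Finset.mem_filter, Finset.mem_insert, Finset.mem_singleton]
      grind
    rw [faceSign, this]; simp
  have h1 : oppositeFace (edge h hK) ⟨v, Finset.mem_insert_self _ _⟩ =
      vertex (face_mem hK (by simp) (by simp) : {w} ∈ K) := by
    apply Subtype.ext
    simp only [oppositeFace, edge, vertex]
    ext x; simp only [Finset.mem_erase, Finset.mem_insert, Finset.mem_singleton]; grind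
  have h2 : oppositeFace (edge h hK) ⟨w, by simp [edge]⟩ =
      vertex (face_mem hK (by simp) (by simp) : {v} ∈ K) := by
    apply Subtype.ext
    simp only [oppositeFace, edge, vertex]
    ext x; simp only [Finset.mem_erase, Finset.mem_insert, Finset.mem_singleton]; grind
  rw [hu, Finset.sum_pair (by simpa [Subtype.ext_iff] using h.ne), h1, h2, hv, hw]
  simp [sub_eq_add_neg]

/-- A triangle of `K`, as a `2`-simplex. -/
def triangle {u v w : V} (huv : u < v) (hvw : v < w) (hK : {u, v, w} ∈ K) : Simplices K 2 :=
  ⟨{u, v, w}, hK, Finset.card_eq_three.mpr ⟨u, v, w, huv.ne, (huv.trans hvw).ne, hvw.ne, rfl⟩⟩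

theorem exists_eq_triangle (s : Simplices K 2) :
    ∃ (u v w : V) (huv : u < v) (hvw : v < w) (hK : {u, v, w} ∈ K), s = triangle huv hvw hK := by
  obtain ⟨s, hs, hc⟩ := s
  let f := s.orderIsoOfFin hc
  have hs' : s = {(f 0).1, (f 1).1, (f 2).1} := by
    ext x
    constructor
    · intro hx
      obtain ⟨i, hi⟩ := f.surjective ⟨x, hx⟩
      have : x = (f i).1 := by rw [hi]
      rw [this]
      fin_cases i <;> simp
    · simp only [Finset.mem_insert, Finset.mem_singleton]
      rintro (h | h | h) <;> rw [h] <;> exact Subtype.mem _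
  refine ⟨f 0, f 1, f 2, ?_, ?_, ?_, ?_⟩
  · exact f.strictMono (by decide)
  · exact f.strictMono (by decide)
  · rw [← hs']; exact hs
  · exact Subtype.ext hs'

theorem boundary_triangle {u v w : V} (huv : u < v) (hvw : v < w) (hK : {u, v, w} ∈ K) :
    boundary K 1 (Finsupp.single (triangle huv hvw hK) 1) =
      Finsupp.single (edge hvw (face_mem hK (by grind) (by simp))) 1 -
        Finsupp.single (edge (huv.trans hvw) (face_mem hK (by grind) (by simp))) 1 +
        Finsupp.single (edge huv (face_mem hK (by grind) (by simp))) 1 := by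
  rw [boundary_single]
  have mu : u ∈ (triangle huv hvw hK).1 := by simp [triangle]
  have mv : v ∈ (triangle huv hvw hK).1 := by simp [triangle]
  have mw : w ∈ (triangle huv hvw hK).1 := by simp [triangle]
  have hun : (Finset.univ : Finset {x // x ∈ (triangle huv hvw hK).1}) =
      {⟨u, mu⟩, ⟨v, mv⟩, ⟨w, mw⟩} := by
    ext ⟨x, hx⟩
    have hx' : x = u ∨ x = v ∨ x = w := by simpa [triangle] using hx
    simpa [Subtype.ext_iff] using hx'
  have su : faceSign (triangle huv hvw hK).1 u = 1 := by
    have : (triangle huv hvw hK).1.filter (· < u) = ∅ := by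
      ext x
      simp only [triangle, Finset.mem_filter, Finset.mem_insert, Finset.mem_singleton]
      grind
    rw [faceSign, this]; simp
  have sv : faceSign (triangle huv hvw hK).1 v = -1 := by
    have : (triangle huv hvw hK).1.filter (· < v) = {u} := by
      ext x
      simp only [triangle, Finset.mem_filter, Finset.mem_insert, Finset.mem_singleton]
      grind
    rw [faceSign, this]; simp
  have sw : faceSign (triangle huv hvw hK).1 w = 1 := by
    have : (triangle huv hvw hK).1.filter (· < w) = {u, v} := by
      ext x
      simp only [triangle, Finset.mem_filter, Finset.mem_insert, Finset.mem_singleton]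
      grind
    rw [faceSign, this, Finset.card_pair huv.ne]; simp
  have h1 : oppositeFace (triangle huv hvw hK) ⟨u, mu⟩ =
      edge hvw (face_mem hK (by grind) (by simp)) := by
    apply Subtype.ext
    simp only [oppositeFace, edge, triangle]
    ext x; simp only [Finset.mem_erase, Finset.mem_insert, Finset.mem_singleton]; grind
  have h2 : oppositeFace (triangle huv hvw hK) ⟨v, mv⟩ =
      edge (huv.trans hvw) (face_mem hK (by grind) (by simp)) := by
    apply Subtype.ext
    simp only [oppositeFace, edge, triangle]
    ext x; simp only [Finset.mem_erase, Finset.mem_insert, Finset.mem_singleton]; grind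
  have h3 : oppositeFace (triangle huv hvw hK) ⟨w, mw⟩ =
      edge huv (face_mem hK (by grind) (by simp)) := by
    apply Subtype.ext
    simp only [oppositeFace, edge, triangle]
    ext x; simp only [Finset.mem_erase, Finset.mem_insert, Finset.mem_singleton]; grind
  rw [hun, Finset.sum_insert (by simp [Subtype.ext_iff, huv.ne, (huv.trans hvw).ne]),
    Finset.sum_pair (by simpa [Subtype.ext_iff] using hvw.ne), h1, h2, h3, su, sv, sw]
  simp only [one_smul, neg_smul]
  abel

variable (K) in
/-- The differential `C₁(K) → C₀(K)` admits a generalized inverse, given by paths from the vertices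
to base points of the connected components. -/
theorem exists_boundary_generalizedInverse :
    ∃ Γ : (Simplices K 0 →₀ ℤ) →+ (Simplices K 1 →₀ ℤ),
      ∀ x, boundary K 0 (Γ (boundary K 0 x)) = boundary K 0 x := by
  let B := (boundary K 0).range
  let q : Simplices K 0 → (Simplices K 0 →₀ ℤ) ⧸ B := fun v => QuotientAddGroup.mk (Finsupp.single v 1)
  -- A base vertex for each class of vertices modulo boundaries. The choice depends on `v` only
  -- through `q v`, so the two ends of an edge get the same base vertex.
  let b : Simplices K 0 → Simplices K 0 := fun v => (⟨v, rfl⟩ : ∃ w, q w = q v).choose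
  have hb (v) : q (b v) = q v := (⟨v, rfl⟩ : ∃ w, q w = q v).choose_spec
  have hbq (v w) (h : q v = q w) : b v = b w := by
    simp only [b, h]
  have hγ (v) : ∃ γ, boundary K 0 γ = -Finsupp.single (b v) 1 + Finsupp.single v 1 :=
    QuotientAddGroup.eq.mp (hb v)
  choose γ hγ using hγ
  let Γ : (Simplices K 0 →₀ ℤ) →+ (Simplices K 1 →₀ ℤ) :=
    Finsupp.liftAddHom fun v => zmultiplesHom _ (γ v)
  have hΓ (v) : Γ (Finsupp.single v 1) = γ v := by simp [Γ]
  refine ⟨Γ, fun x => ?_⟩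
  suffices h : ((boundary K 0).comp Γ).comp (boundary K 0) = boundary K 0 from DFunLike.congr_fun h x
  refine Finsupp.addHom_ext' fun s => AddMonoidHom.ext_int ?_
  obtain ⟨v, w, hvw, hK, rfl⟩ := exists_eq_edge s
  simp only [AddMonoidHom.comp_apply, Finsupp.singleAddHom_apply]
  have he := boundary_edge hvw hK
  have hbb := hbq (vertex (face_mem hK (by simp) (by simp) : {v} ∈ K))
    (vertex (face_mem hK (by simp) (by simp) : {w} ∈ K))
    (QuotientAddGroup.eq.mpr ⟨_, he.trans (by abel)⟩)
  rw [he, map_sub, map_sub, hΓ, hΓ, hγ, hγ, hbb]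
  abel

variable (K) in
theorem nonempty_cohomology_chains_equiv (D : Type u) [AddCommGroup D] (n : ℕ) (hn : n ≤ 1) :
    Nonempty (Cohomology (chains K) D n ≃+ ((chains K).homology n →+ D)) := by
  interval_cases n
  -- The differential out of degree 0 is zero, so `Γ = 0` serves as its generalized inverse.
  · have h0 : (chains K).d 0 (0 - 1) = 0 := (chains K).shape _ _ (by simp)
    refine nonempty_cohomology_equiv D 0 fun x => ?_
    rw [h0]
    rfl
  · obtain ⟨Γ, hΓ⟩ := exists_boundary_generalizedInverse K
    refine nonempty_cohomology_equiv D Γ ?_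
    change ∀ x, ((chains K).d (0 + 1) 0).hom (Γ (((chains K).d (0 + 1) 0).hom x)) =
      ((chains K).d (0 + 1) 0).hom x
    rw [chains_d]
    exact hΓ

variable (K) in
-- The generalized inverse embeds `H₀` into the free group on finitely many vertices, and subgroups
-- of such groups are free of finite rank.
theorem free_and_finite_homology_zero [Finite V] :
    Module.Free ℤ ((chains K).homology 0) ∧ Module.Finite ℤ ((chains K).homology 0) := by
  obtain ⟨Γ, hΓ⟩ := exists_boundary_generalizedInverse K
  have hd := chains_d K 0
  obtain ⟨j, hj⟩ := exists_injective_homology_zero (C := chains K) Γ (by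
    change ∀ x, ((chains K).d (0 + 1) 0).hom (Γ (((chains K).d (0 + 1) 0).hom x)) =
      ((chains K).d (0 + 1) 0).hom x
    rw [hd]
    exact hΓ)
  let j' : (chains K).homology 0 →ₗ[ℤ] (Simplices K 0 →₀ ℤ) := AddMonoidHom.toIntLinearMap j
  have := Module.Finite.of_injective j' hj
  exact ⟨Module.Free.of_equiv (LinearEquiv.ofInjective j' hj).symm, this⟩

theorem card_addMonoidHom_of_free (M : Type v) [AddCommGroup M] [Module.Free ℤ M]
    [Module.Finite ℤ M] (D : Type u) [AddCommGroup D] :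
    Nat.card (M →+ D) = Nat.card D ^ Module.finrank ℤ M := by
  let b := Module.Free.chooseBasis ℤ M
  let e : (M →+ D) ≃ (Module.Free.ChooseBasisIndex ℤ M → D) :=
    (addMonoidHomLequivInt (A := M) (B := D) ℤ).toEquiv.trans (b.constr ℤ).symm.toEquiv
  rw [Nat.card_congr e, Nat.card_fun, Module.finrank_eq_card_chooseBasisIndex,
    Nat.card_eq_fintype_card (α := Module.Free.ChooseBasisIndex ℤ M)]

/-- Homomorphisms to `ℚ` form the dual of `ℚ ⊗ M`, whose dimension is the rank of `M`. No finiteness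
is needed, since `finrank` is `0` for a space and its dual alike in infinite dimension. -/
theorem finrank_addMonoidHom_rat (M : Type v) [AddCommGroup M] :
    Module.finrank ℚ (M →+ ℚ) = Module.finrank ℤ M := by
  let e : (M →+ ℚ) ≃+ Module.Dual ℚ (TensorProduct ℤ ℚ M) :=
    (addMonoidHomLequivInt (A := M) (B := ℚ) ℤ).toAddEquiv.trans
      (LinearMap.liftBaseChangeEquiv (R := ℤ) (M := M) (N := ℚ) ℚ).toAddEquiv
  have e' : (M →+ ℚ) ≃ₗ[ℚ] Module.Dual ℚ (TensorProduct ℤ ℚ M) :=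
    { e with map_smul' := fun c x => map_rat_smul e.toAddMonoidHom c x }
  rw [e'.finrank_eq, Subspace.dual_finrank_eq, IsFractionRing.finrank_right_eq ℤ ℚ,
    ← IsLocalizedModule.finrank_eq (nonZeroDivisors ℤ) (TensorProduct.mk ℤ ℚ M 1) le_rfl]
  congr 1

end Chains

/-! ### Isomorphisms of subquotients -/

section Subquotient

variable {A B : Type*} [AddCommGroup A] [AddCommGroup B]

/-- A homomorphism inducing a bijection on subquotients induces an isomorphism of subquotients. -/
theorem nonempty_subquotient_equiv (φ : A →+ B) (ZA BA : AddSubgroup A) (ZB BB : AddSubgroup B)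
    (hZ : ∀ a ∈ ZA, φ a ∈ ZB) (hB : ∀ a ∈ ZA, φ a ∈ BB ↔ a ∈ BA)
    (hsurj : ∀ b ∈ ZB, ∃ a ∈ ZA, b - φ a ∈ BB) :
    Nonempty ((ZA ⧸ BA.addSubgroupOf ZA) ≃+ (ZB ⧸ BB.addSubgroupOf ZB)) := by
  let ψ : ZA →+ ZB ⧸ BB.addSubgroupOf ZB :=
    (QuotientAddGroup.mk' _).comp ((φ.comp ZA.subtype).codRestrict ZB fun a => hZ a.1 a.2)
  have hker : ψ.ker = BA.addSubgroupOf ZA := by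
    ext a
    exact (QuotientAddGroup.eq_zero_iff _).trans (hB a.1 a.2)
  have hψ : Function.Surjective ψ := by
    intro q
    induction q using QuotientAddGroup.induction_on with
    | H b =>
      obtain ⟨a, ha, hab⟩ := hsurj b.1 b.2
      refine ⟨⟨a, ha⟩, QuotientAddGroup.eq.mpr ?_⟩
      change -φ a + b.1 ∈ BB
      rwa [neg_add_eq_sub]
  exact ⟨(QuotientAddGroup.quotientAddEquivOfEq hker.symm).trans
    (QuotientAddGroup.quotientKerEquivOfSurjective ψ hψ)⟩

end Subquotient

/-! ### Uniform Alexander–Spanier cohomology in degree 1 -/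

section AlexanderSpanier

variable (X : Type*) [PseudoMetricSpace X] (D : Type*) [AddCommGroup D]

/-- Alexander–Spanier `1`-cocycles of a metric space, uniform version: functions of two variables
which are additive on sufficiently small triples. -/
def smallCocycles : AddSubgroup (X → X → D) where
  carrier := {f | ∃ ε > 0, ∀ x y z, dist x y < ε → dist y z < ε → dist x z < ε →
    f x y + f y z = f x z}
  zero_mem' := ⟨1, one_pos, fun _ _ _ _ _ _ => add_zero 0⟩
  add_mem' := by
    rintro f g ⟨ε, hε, hf⟩ ⟨η, hη, hg⟩
    refine ⟨min ε η, lt_min hε hη, fun x y z h1 h2 h3 => ?_⟩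
    rw [lt_min_iff] at h1 h2 h3
    change f x y + g x y + (f y z + g y z) = f x z + g x z
    rw [← hf x y z h1.1 h2.1 h3.1, ← hg x y z h1.2 h2.2 h3.2]
    abel
  neg_mem' := by
    rintro f ⟨ε, hε, hf⟩
    refine ⟨ε, hε, fun x y z h1 h2 h3 => ?_⟩
    change -f x y + -f y z = -f x z
    rw [← hf x y z h1 h2 h3]
    abel

/-- Alexander–Spanier `1`-coboundaries of a metric space, uniform version. -/
def smallCoboundaries : AddSubgroup (X → X → D) where
  carrier := {f | ∃ g : X → D, ∃ ε > 0, ∀ x y, dist x y < ε → f x y = g y - g x}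
  zero_mem' := ⟨0, 1, one_pos, fun _ _ _ => (sub_zero 0).symm⟩
  add_mem' := by
    rintro f f' ⟨g, ε, hε, hf⟩ ⟨g', η, hη, hf'⟩
    refine ⟨g + g', min ε η, lt_min hε hη, fun x y h => ?_⟩
    rw [lt_min_iff] at h
    change f x y + f' x y = g y + g' y - (g x + g' x)
    rw [hf x y h.1, hf' x y h.2]
    abel
  neg_mem' := by
    rintro f ⟨g, ε, hε, hf⟩
    refine ⟨-g, ε, hε, fun x y h => ?_⟩
    change -f x y = -g y - -g x
    rw [hf x y h]
    abel

/-- The first Alexander–Spanier cohomology group of a metric space, uniform version. -/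
abbrev SmallCohomology : Type _ :=
  smallCocycles X D ⧸ (smallCoboundaries X D).addSubgroupOf (smallCocycles X D)

variable {X} {Y : Type*} [PseudoMetricSpace Y]

variable {D}

theorem pullback_mem_smallCocycles {e : X → Y} (he : UniformContinuous e) {f : Y → Y → D}
    (hf : f ∈ smallCocycles Y D) : (fun x y => f (e x) (e y)) ∈ smallCocycles X D := by
  obtain ⟨ε, hε, hf⟩ := hf
  obtain ⟨δ, hδ, h⟩ := Metric.uniformContinuous_iff.mp he ε hε
  exact ⟨δ, hδ, fun x y z h1 h2 h3 => hf _ _ _ (h h1) (h h2) (h h3)⟩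

theorem pullback_mem_smallCoboundaries {e : X → Y} (he : UniformContinuous e) {f : Y → Y → D}
    (hf : f ∈ smallCoboundaries Y D) : (fun x y => f (e x) (e y)) ∈ smallCoboundaries X D := by
  obtain ⟨g, ε, hε, hf⟩ := hf
  obtain ⟨δ, hδ, h⟩ := Metric.uniformContinuous_iff.mp he ε hε
  exact ⟨g ∘ e, δ, hδ, fun x y h1 => hf _ _ (h h1)⟩

variable (D) in
-- Uniform continuity turns smallness in one space into smallness in the other. Between compact
-- spaces it is automatic for homeomorphisms, which gives topological invariance.
theorem nonempty_smallCohomology_equiv (e : X ≃ Y) (he : UniformContinuous e)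
    (he' : UniformContinuous e.symm) :
    Nonempty (SmallCohomology Y D ≃+ SmallCohomology X D) := by
  let φ : (Y → Y → D) →+ (X → X → D) :=
    { toFun := fun f x y => f (e x) (e y)
      map_zero' := rfl
      map_add' := fun _ _ => rfl }
  refine nonempty_subquotient_equiv φ _ _ _ _ (fun f hf => pullback_mem_smallCocycles he hf)
    (fun f _ => ⟨fun h => ?_, fun h => pullback_mem_smallCoboundaries he h⟩)
    fun f hf => ⟨_, pullback_mem_smallCocycles he' hf, ?_⟩
  · have := pullback_mem_smallCoboundaries he' h
    simpa [φ] using this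
  · convert (smallCoboundaries X D).zero_mem using 1
    ext x y
    simp [φ]

end AlexanderSpanier

/-! ### Discrete contractions and primitives of cocycles -/

section ChainContractible

variable {X : Type*} [PseudoMetricSpace X] {D : Type*} [AddCommGroup D]

/-- `S` can be contracted to `o` inside `S` in arbitrarily small nonexpansive steps, of which
finitely many suffice for each point. -/
def IsChainContractible (S : Set X) (o : X) : Prop :=
  ∀ δ > 0, ∃ h : ℕ → X → X, (∀ x ∈ S, h 0 x = o) ∧ (∀ k, Set.MapsTo (h k) S S) ∧
    (∀ k, ∀ x ∈ S, ∀ y ∈ S, dist (h k x) (h k y) ≤ dist x y) ∧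
    (∀ k, ∀ x ∈ S, dist (h k x) (h (k + 1) x) < δ) ∧ ∀ x ∈ S, ∃ N, ∀ k ≥ N, h k x = x

/-- The contraction joins `o` to `x` by finitely many steps shorter than `ε`, and `φ` is unchanged
at each. -/
theorem IsChainContractible.eq_of_locally_const {S : Set X} {o : X} (hS : IsChainContractible S o)
    {α : Type*} (φ : X → α) {ε : ℝ} (hε : 0 < ε)
    (hφ : ∀ x ∈ S, ∀ y ∈ S, dist x y < ε → φ x = φ y) {x : X} (hx : x ∈ S) : φ x = φ o := by
  obtain ⟨h, h0, hm, -, hstep, hend⟩ := hS ε hε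
  have key (k : ℕ) : φ (h k x) = φ o := by
    induction k with
    | zero => rw [h0 x hx]
    | succ k ih => rw [← ih, hφ _ (hm k hx) _ (hm (k + 1) hx) (hstep k x hx)]
  obtain ⟨N, hN⟩ := hend x hx
  rw [← key N, hN N le_rfl]

/-- A discrete Poincaré lemma: `g x` is the sum of `f` along the chain from `o` to `x`. Chains of
close points form a ladder with small squares, around which `f` sums to zero. -/
theorem IsChainContractible.exists_primitive {S : Set X} {o : X} (hS : IsChainContractible S o)
    (f : X → X → D) {ε : ℝ} (hε : 0 < ε)
    (hf : ∀ x ∈ S, ∀ y ∈ S, ∀ z ∈ S, dist x y < ε → dist y z < ε → dist x z < ε →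
      f x y + f y z = f x z) :
    ∃ g : X → D, g o = 0 ∧ ∀ x ∈ S, ∀ y ∈ S, dist x y < ε / 2 → f x y = g y - g x := by
  obtain ⟨h, h0, hm, hne, hstep, hend⟩ := hS (ε / 2) (half_pos hε)
  have hself : ∀ x ∈ S, f x x = 0 := by
    intro x hx
    have := hf x hx x hx x hx (by simpa) (by simpa) (by simpa)
    simpa using this
  choose! N hN using hend
  -- Once the chain has reached `x`, further terms are `f x x = 0`; so `F n x` stabilizes, though
  -- not uniformly in `x`.
  let F : ℕ → X → D := fun n x => ∑ i ∈ Finset.range n, f (h i x) (h (i + 1) x)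
  have hF : ∀ x ∈ S, ∀ n ≥ N x, F n x = F (N x) x := by
    intro x hx n hn
    induction n, hn using Nat.le_induction with
    | base => rfl
    | succ n hn ih =>
      simp only [F] at ih ⊢
      rw [Finset.sum_range_succ, ih, hN x hx n hn, hN x hx (n + 1) (by omega), hself x hx, add_zero]
  refine ⟨fun x => F (N x) x - F (N o) o, sub_self _, fun x hx y hy hxy => ?_⟩
  have ho : o ∈ S := by
    have := hm 0 hx
    rwa [h0 x hx] at this
  have key (n : ℕ) : F n x + f (h n x) (h n y) = F n y := by
    induction n with
    | zero => simp [F, h0 x hx, h0 y hy, hself o ho]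
    | succ n ih =>
      simp only [F] at ih ⊢
      rw [Finset.sum_range_succ, Finset.sum_range_succ, ← ih]
      have a1 := hm n hx
      have a2 := hm (n + 1) hx
      have b1 := hm n hy
      have b2 := hm (n + 1) hy
      have d1 := hne n x hx y hy
      have d2 := hne (n + 1) x hx y hy
      have d3 := hstep n x hx
      have d4 := hstep n y hy
      -- The diagonal of the square: two sides below `ε / 2`. It cuts the square into two triangles
      -- on which `f` is additive.
      have d5 : dist (h n x) (h (n + 1) y) < ε := by
        linarith [dist_triangle (h n x) (h (n + 1) x) (h (n + 1) y)]
      have e1 := hf _ a1 _ a2 _ b2 (by linarith) (by linarith) d5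
      have e2 := hf _ a1 _ b1 _ b2 (by linarith) (by linarith) d5
      rw [add_assoc, e1, ← e2, add_assoc]
  have hk := key (max (N x) (N y))
  rw [hF x hx _ (le_max_left _ _), hF y hy _ (le_max_right _ _), hN x hx _ (le_max_left _ _),
    hN y hy _ (le_max_right _ _)] at hk
  change f x y = F (N y) y - F (N o) o - (F (N x) x - F (N o) o)
  rw [← hk]
  abel

end ChainContractible

/-! ### Ordered cochains compute simplicial H¹ -/

section OrderedCochains

variable {V : Type v} [LinearOrder V] (K : PreAbstractSimplicialComplex V)
variable (D : Type u) [AddCommGroup D]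

/-- Ordered simplicial `1`-cocycles: functions of two vertices, additive on triples of vertices
spanning a (possibly degenerate) simplex. -/
def orderedCocycles : AddSubgroup (V → V → D) where
  carrier := {c | ∀ u v w, {u, v, w} ∈ K → c u v + c v w = c u w}
  zero_mem' := fun _ _ _ _ => add_zero 0
  add_mem' := by
    intro f g hf hg u v w h
    change f u v + g u v + (f v w + g v w) = f u w + g u w
    rw [← hf u v w h, ← hg u v w h]
    abel
  neg_mem' := by
    intro f hf u v w h
    change -f u v + -f v w = -f u w
    rw [← hf u v w h]
    abel

/-- Ordered simplicial `1`-coboundaries. -/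
def orderedCoboundaries : AddSubgroup (V → V → D) where
  carrier := {c | ∃ g : V → D, ∀ u v, {u, v} ∈ K → c u v = g v - g u}
  zero_mem' := ⟨0, fun _ _ _ => (sub_zero 0).symm⟩
  add_mem' := by
    rintro f f' ⟨g, hf⟩ ⟨g', hf'⟩
    refine ⟨g + g', fun u v h => ?_⟩
    change f u v + f' u v = g v + g' v - (g u + g' u)
    rw [hf u v h, hf' u v h]
    abel
  neg_mem' := by
    rintro f ⟨g, hf⟩
    refine ⟨-g, fun u v h => ?_⟩
    change -f u v = -g v - -g u
    rw [hf u v h]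
    abel

/-- The first simplicial cohomology group, computed with ordered cochains. -/
abbrev OrderedCohomology : Type _ :=
  orderedCocycles K D ⧸ (orderedCoboundaries K D).addSubgroupOf (orderedCocycles K D)

open Classical in
/-- The oriented edge from `u` to `v` as a `1`-chain; zero if there is no such edge. -/
noncomputable def orientedEdge (u v : V) : Simplices K 1 →₀ ℤ :=
  if h : u < v ∧ {u, v} ∈ K then Finsupp.single (edge h.1 h.2) 1
  else if h : v < u ∧ {v, u} ∈ K then -Finsupp.single (edge h.1 h.2) 1
  else 0

variable {K D}

theorem orientedEdge_of_lt {u v : V} (h : u < v) (hK : {u, v} ∈ K) :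
    orientedEdge K u v = Finsupp.single (edge h hK) 1 :=
  dif_pos ⟨h, hK⟩

theorem orientedEdge_self (u : V) : orientedEdge K u u = 0 := by
  simp [orientedEdge]

theorem orientedEdge_swap (u v : V) : orientedEdge K v u = -orientedEdge K u v := by
  unfold orientedEdge
  split_ifs with h1 h2 h2
  · exact absurd h1.1 h2.1.not_gt
  · rw [neg_neg]
  · rfl
  · rw [neg_zero]

/-- For increasing vertices this is vanishing on the boundary of a triangle; antisymmetry reduces
every other order to that one, and degenerate triples are trivial. -/
theorem map_orientedEdge_add (f : (Simplices K 1 →₀ ℤ) →+ D) (hf : ∀ x, f (boundary K 1 x) = 0)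
    {u v w : V} (h : {u, v, w} ∈ K) :
    f (orientedEdge K u v) + f (orientedEdge K v w) = f (orientedEdge K u w) := by
  let c : V → V → D := fun u v => f (orientedEdge K u v)
  have hself (u) : c u u = 0 := by simp [c, orientedEdge_self]
  have hswap (u v) : c v u = -c u v := by simp [c, orientedEdge_swap u v]
  have hlt : ∀ u v w, u < v → v < w → {u, v, w} ∈ K → c u v + c v w = c u w := by
    intro u v w huv hvw hK
    have h0 := hf (Finsupp.single (triangle huv hvw hK) 1)
    rw [boundary_triangle, map_add, map_sub, ← orientedEdge_of_lt, ← orientedEdge_of_lt,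
      ← orientedEdge_of_lt] at h0
    change c v w - c u w + c u v = 0 at h0
    rw [← sub_eq_zero, ← h0]
    abel
  change c u v + c v w = c u w
  rcases lt_trichotomy u v with huv | rfl | huv
  · rcases lt_trichotomy v w with hvw | rfl | hvw
    · exact hlt u v w huv hvw h
    · rw [hself, add_zero]
    · rcases lt_trichotomy u w with huw | rfl | huw
      · rw [← hlt u w v huw hvw (by convert h using 1; grind), hswap w v]; abel
      · rw [hself, hswap u v, add_neg_cancel]
      · rw [hswap w u, hswap w v, ← hlt w u v huw huv (by convert h using 1; grind)]; abel
  · rw [hself, zero_add]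
  · rcases lt_trichotomy v w with hvw | rfl | hvw
    · rcases lt_trichotomy u w with huw | rfl | huw
      · rw [hswap v u, ← hlt v u w huv huw (by convert h using 1; grind)]; abel
      · rw [hself, hswap v u, neg_add_cancel]
      · rw [hswap v u, hswap w u, ← hlt v w u hvw huw (by convert h using 1; grind)]; abel
    · rw [hself, add_zero]
    · rw [hswap w u, hswap v u, hswap w v, ← hlt w v u hvw huv (by convert h using 1; grind)]; abel

theorem boundary_orientedEdge {u v : V} (h : {u, v} ∈ K) :
    boundary K 0 (orientedEdge K u v) =
      Finsupp.single (vertex (face_mem h (by simp) (by simp) : {v} ∈ K)) 1 -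
        Finsupp.single (vertex (face_mem h (by simp) (by simp) : {u} ∈ K)) 1 := by
  rcases lt_trichotomy u v with huv | rfl | huv
  · rw [orientedEdge_of_lt huv h, boundary_edge]
  · rw [orientedEdge_self, map_zero, sub_self]
  · have h' : {v, u} ∈ K := by rwa [Finset.pair_comm]
    rw [orientedEdge_swap v u, map_neg, orientedEdge_of_lt huv h', boundary_edge, neg_sub]

variable (K D) in
-- Evaluation on oriented edges. An ordered cocycle is antisymmetric on edges and zero on the
-- diagonal at vertices of `K`, so its values on increasing edges determine it there.
theorem nonempty_cohomology_one_equiv_ordered :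
    Nonempty (Cohomology (chains K) D 1 ≃+ OrderedCohomology K D) := by
  let φ : ((chains K).X 1 →+ D) →+ (V → V → D) :=
    { toFun := fun f u v => f (orientedEdge K u v)
      map_zero' := rfl
      map_add' := fun _ _ => rfl }
  have hcyc (f : (chains K).X 1 →+ D) :
      f ∈ cocycles (chains K) D 1 ↔ ∀ x, f (boundary K 1 x) = 0 := by
    rw [← chains_d]
    exact DFunLike.ext_iff
  have hcob (f : (chains K).X 1 →+ D) : f ∈ coboundaries (chains K) D 1 ↔
      ∃ g : (Simplices K 0 →₀ ℤ) →+ D, ∀ x, g (boundary K 0 x) = f x := by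
    rw [← chains_d]
    exact exists_congr fun g => DFunLike.ext_iff
  have hext (f g : (Simplices K 1 →₀ ℤ) →+ D)
      (h : ∀ u v, {u, v} ∈ K → f (orientedEdge K u v) = g (orientedEdge K u v)) : f = g := by
    refine Finsupp.addHom_ext' fun s => AddMonoidHom.ext_int ?_
    obtain ⟨u, v, huv, hK, rfl⟩ := exists_eq_edge s
    have := h u v hK
    rwa [orientedEdge_of_lt huv hK] at this
  refine nonempty_subquotient_equiv φ _ _ _ _ ?_ ?_ ?_
  · intro f hf u v w h
    exact map_orientedEdge_add f ((hcyc f).mp hf) h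
  · intro f _
    rw [hcob]
    classical
    constructor
    · rintro ⟨g, hg⟩
      -- `min'` merely reads off the vertex of a `0`-simplex.
      let g' : (Simplices K 0 →₀ ℤ) →+ D :=
        Finsupp.liftAddHom fun s => zmultiplesHom _
          (g (s.1.min' (Finset.card_pos.mp (by rw [s.2.2]; omega))))
      have hg' {v : V} (hv : {v} ∈ K) : g' (Finsupp.single (vertex hv) 1) = g v := by
        simp [g', vertex]
      refine ⟨g', fun x => DFunLike.congr_fun (hext (g'.comp (boundary K 0)) f fun u v h => ?_) x⟩
      rw [AddMonoidHom.comp_apply, boundary_orientedEdge h, map_sub, hg', hg']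
      exact (hg u v h).symm
    · rintro ⟨g, hg⟩
      refine ⟨fun v => if hv : {v} ∈ K then g (Finsupp.single (vertex hv) 1) else 0,
        fun u v h => ?_⟩
      have hu : {u} ∈ K := face_mem h (by simp) (by simp)
      have hv : {v} ∈ K := face_mem h (by simp) (by simp)
      have : φ f u v = f (orientedEdge K u v) := rfl
      rw [this, ← hg, boundary_orientedEdge h, map_sub]
      simp only [dif_pos hu, dif_pos hv]
  · intro c hc
    let f : (Simplices K 1 →₀ ℤ) →+ D :=
      Finsupp.liftAddHom fun s => zmultiplesHom _
        (c (s.1.min' (Finset.card_pos.mp (by rw [s.2.2]; omega)))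
          (s.1.max' (Finset.card_pos.mp (by rw [s.2.2]; omega))))
    have hself {u : V} (hu : {u} ∈ K) : c u u = 0 := by
      have := hc u u u (by simpa using hu)
      simpa using this
    have hfe {u v : V} (huv : u < v) (h : {u, v} ∈ K) :
        f (Finsupp.single (edge huv h) 1) = c u v := by
      simp [f, edge, Finset.min'_insert, Finset.max'_insert, huv.le]
    have hf {u v : V} (h : {u, v} ∈ K) : f (orientedEdge K u v) = c u v := by
      rcases lt_trichotomy u v with huv | rfl | huv
      · rw [orientedEdge_of_lt huv h, hfe]
      · rw [orientedEdge_self, map_zero, hself (by simpa using h)]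
      · have h' : {v, u} ∈ K := by rwa [Finset.pair_comm]
        rw [orientedEdge_swap v u, map_neg, orientedEdge_of_lt huv h', hfe]
        have := hc u v u (by convert h using 1; grind)
        rw [hself (face_mem h (by simp) (by simp))] at this
        exact (eq_neg_of_add_eq_zero_left this).symm
    -- The primitive `0` suffices: `c` and the image of `f` agree on edges, and
    -- `orderedCoboundaries` does not constrain other pairs.
    refine ⟨f, (hcyc f).mpr fun x => ?_, 0, fun u v h => ?_⟩
    · suffices h : f.comp (boundary K 1) = 0 from DFunLike.congr_fun h x
      refine Finsupp.addHom_ext' fun s => AddMonoidHom.ext_int ?_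
      obtain ⟨u, v, w, huv, hvw, hK, rfl⟩ := exists_eq_triangle s
      simp only [AddMonoidHom.comp_apply, Finsupp.singleAddHom_apply]
      rw [boundary_triangle, map_add, map_sub, hfe, hfe, hfe, ← hc u v w hK]
      simp
    · change c u v - f (orientedEdge K u v) = 0 - 0
      rw [hf h, sub_self, sub_self]

end OrderedCochains

/-! ### The realization: top vertices and contractible closed stars -/

section Realization

variable {V : Type v} [Fintype V] {A : PreAbstractSimplicialComplex V}

open Classical in
/-- The support of a point of the realization: the vertices with nonzero coordinate. -/
noncomputable def carrier (x : V → ℝ) : Finset V := Finset.univ.filter fun v => x v ≠ 0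

theorem mem_carrier {x : V → ℝ} {v : V} : v ∈ carrier x ↔ x v ≠ 0 := by
  simp [carrier]

theorem carrier_mem (x : realization A) : carrier x.1 ∈ A := by
  obtain ⟨-, h1, s, hs, h⟩ := x.2
  refine face_mem hs (fun v hv => ?_) ?_
  · by_contra hvs
    exact mem_carrier.mp hv (h v hvs)
  · by_contra hne
    rw [Finset.not_nonempty_iff_eq_empty, Finset.eq_empty_iff_forall_notMem] at hne
    have : ∑ v, x.1 v = 0 :=
      Finset.sum_eq_zero fun v _ => not_not.mp fun h => hne v (mem_carrier.mpr h)
    linarith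

theorem single_mem_realization [DecidableEq V] {u : V} (hu : {u} ∈ A) :
    (Pi.single u 1 : V → ℝ) ∈ realization A := by
  refine ⟨fun v => ?_, by simp, {u}, hu, fun v hv => ?_⟩
  · by_cases h : v = u
    · subst h; simp
    · simp [h]
  · have : v ≠ u := by simpa using hv
    simp [this]

theorem carrier_single [DecidableEq V] (u : V) : carrier (Pi.single u 1 : V → ℝ) = {u} := by
  ext v
  rw [mem_carrier, Finset.mem_singleton]
  by_cases h : v = u
  · subst h; simp
  · simp [h]

theorem coord_le_one (x : realization A) (v : V) : x.1 v ≤ 1 := by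
  rw [← x.2.2.1]
  exact Finset.single_le_sum (fun w _ => x.2.1 w) (Finset.mem_univ v)

theorem exists_large_coord (x : realization A) : ∃ v, (Fintype.card V : ℝ)⁻¹ ≤ x.1 v := by
  by_contra! h
  have hne : (Finset.univ : Finset V).Nonempty := by
    by_contra hne
    have := x.2.2.1
    rw [Finset.not_nonempty_iff_eq_empty.mp hne] at this
    simp at this
  have h1 := Finset.sum_lt_sum_of_nonempty hne fun v _ => h v
  rw [x.2.2.1, Finset.sum_const, Finset.card_univ, nsmul_eq_mul, mul_inv_cancel₀] at h1
  · exact lt_irrefl _ h1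
  · have := Finset.card_pos.mpr hne
    rw [Finset.card_univ] at this
    positivity

/-- A vertex of the carrier of `x` with large coordinate. -/
noncomputable def topVertex (x : realization A) : V := (exists_large_coord x).choose

/-- If that coordinate of `y` vanished, the sup distance would be at least `1 / card V`. So close
points have top vertices in a common simplex, which lets simplicial cochains be pulled back. -/
theorem topVertex_mem_carrier {x y : realization A} (h : dist x y < (Fintype.card V : ℝ)⁻¹) :
    topVertex x ∈ carrier y.1 := by
  rw [mem_carrier]
  intro h0
  have h1 := (exists_large_coord x).choose_spec
  have h2 : dist (x.1 (topVertex x)) (y.1 (topVertex x)) ≤ dist x y := dist_le_pi_dist x.1 y.1 _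
  rw [h0, Real.dist_eq, sub_zero] at h2
  have h3 : x.1 (topVertex x) ≤ |x.1 (topVertex x)| := le_abs_self _
  have h4 : (Fintype.card V : ℝ)⁻¹ ≤ x.1 (topVertex x) := h1
  linarith

theorem inv_card_pos (x : realization A) : 0 < (Fintype.card V : ℝ)⁻¹ := by
  have : 0 < Fintype.card V := Fintype.card_pos_iff.mpr ⟨topVertex x⟩
  positivity

variable [DecidableEq V]

theorem topVertex_single {u : V} (hu : {u} ∈ A) :
    topVertex (⟨_, single_mem_realization hu⟩ : realization A) = u := by
  have h := topVertex_mem_carrier (A := A) (x := ⟨_, single_mem_realization hu⟩)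
    (y := ⟨_, single_mem_realization hu⟩) (by rw [dist_self]; exact inv_card_pos ⟨_, single_mem_realization hu⟩)
  rw [carrier_single] at h
  exact Finset.mem_singleton.mp h

variable (A) in
/-- The closed star of a set of vertices `s` in the realization. -/
def closedStar (s : Finset V) : Set (realization A) := {x | s ∪ carrier x.1 ∈ A}

theorem combo_mem {s : Finset V} {u : V} (hu : u ∈ s) {x : realization A} (hx : x ∈ closedStar A s)
    {t : ℝ} (h0 : 0 ≤ t) (h1 : t ≤ 1) :
    ∃ h : (1 - t) • Pi.single u 1 + t • x.1 ∈ realization A,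
      (⟨_, h⟩ : realization A) ∈ closedStar A s := by
  have hsupp : ∀ v, v ∉ s ∪ carrier x.1 → ((1 - t) • Pi.single u 1 + t • x.1 : V → ℝ) v = 0 := by
    intro v hv
    rw [Finset.mem_union, not_or, mem_carrier, not_not] at hv
    have : v ≠ u := fun h => hv.1 (h ▸ hu)
    simp [this, hv.2]
  refine ⟨⟨fun v => ?_, ?_, s ∪ carrier x.1, hx, hsupp⟩, ?_⟩
  · have hs : (0 : ℝ) ≤ (Pi.single u 1 : V → ℝ) v := by
      by_cases h : v = u
      · subst h; simp
      · simp [h]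
    have := x.2.1 v
    simp only [Pi.add_apply, Pi.smul_apply, smul_eq_mul]
    exact add_nonneg (mul_nonneg (by linarith) hs) (mul_nonneg h0 this)
  · simp only [Pi.add_apply, Pi.smul_apply, smul_eq_mul]
    rw [Finset.sum_add_distrib, ← Finset.mul_sum, ← Finset.mul_sum, x.2.2.1]
    simp
  · refine face_mem hx (Finset.union_subset Finset.subset_union_left fun v hv => ?_)
      ⟨u, Finset.mem_union_left _ hu⟩
    by_contra hv'
    exact mem_carrier.mp hv (hsupp v hv')

/-- The straight-line contraction to `u`, at times `min 1 (k / n)`. Coordinates lie in `[0, 1]`, so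
each step has sup length at most `1 / n < δ`. -/
theorem isChainContractible_closedStar {s : Finset V} {u : V} (hu : u ∈ s) (huA : {u} ∈ A) :
    IsChainContractible (closedStar A s) ⟨_, single_mem_realization huA⟩ := by
  classical
  intro δ hδ
  obtain ⟨n, hn⟩ := exists_nat_gt (1 / δ)
  have hn0 : (0 : ℝ) < n := (by positivity : 0 < 1 / δ).trans hn
  let t : ℕ → ℝ := fun k => min 1 (k / n)
  have ht0 (k) : 0 ≤ t k := le_min zero_le_one (by positivity)
  have ht1 (k) : t k ≤ 1 := min_le_left _ _
  let h : ℕ → realization A → realization A := fun k x =>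
    if hx : x ∈ closedStar A s then ⟨_, (combo_mem hu hx (ht0 k) (ht1 k)).choose⟩ else x
  have hh (k) {x} (hx : x ∈ closedStar A s) :
      (h k x).1 = (1 - t k) • Pi.single u 1 + t k • x.1 := by
    simp only [h, dif_pos hx]
  refine ⟨h, fun x hx => ?_, fun k x hx => ?_, fun k x hx y hy => ?_, fun k x hx => ?_,
    fun x hx => ⟨n, fun k hk => ?_⟩⟩
  · apply Subtype.ext
    rw [hh 0 hx]
    simp [t]
  · simp only [h, dif_pos hx]
    exact (combo_mem hu hx (ht0 k) (ht1 k)).choose_spec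
  · rw [Subtype.dist_eq, hh k hx, hh k hy, dist_add_left, dist_smul₀, Real.norm_eq_abs,
      abs_of_nonneg (ht0 k)]
    exact mul_le_of_le_one_left dist_nonneg (ht1 k)
  · have hstep : |t k - t (k + 1)| < δ := by
      refine (abs_min_sub_min_le_max _ _ _ _).trans_lt ?_
      rw [sub_self, abs_zero, max_eq_right (abs_nonneg _), ← sub_div]
      push_cast
      rw [sub_add_cancel_left, abs_div, abs_neg, abs_one, abs_of_pos hn0, div_lt_iff₀ hn0]
      rwa [div_lt_iff₀ hδ, mul_comm] at hn
    refine lt_of_le_of_lt ?_ hstep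
    rw [Subtype.dist_eq, hh k hx, hh (k + 1) hx, dist_pi_le_iff (abs_nonneg _)]
    intro v
    have e : ((1 - t k) • Pi.single u 1 + t k • x.1 : V → ℝ) v -
        ((1 - t (k + 1)) • Pi.single u 1 + t (k + 1) • x.1 : V → ℝ) v =
        (t k - t (k + 1)) * (x.1 v - (Pi.single u 1 : V → ℝ) v) := by
      simp only [Pi.add_apply, Pi.smul_apply, smul_eq_mul]
      ring
    rw [Real.dist_eq, e, abs_mul]
    refine mul_le_of_le_one_right (abs_nonneg _) ?_
    have b0 := x.2.1 v
    have b1 := coord_le_one x v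
    by_cases h : v = u
    · subst h
      rw [Pi.single_eq_same, abs_le]
      constructor <;> linarith
    · rw [Pi.single_eq_of_ne h, abs_le]
      constructor <;> linarith
  · apply Subtype.ext
    have : t k = 1 := min_eq_left (by
      rw [le_div_iff₀ hn0, one_mul]
      exact_mod_cast hk)
    rw [hh k hx, this]
    simp

end Realization

/-! ### Simplicial H¹ equals Alexander–Spanier H¹ of the realization -/

section Comparison

variable {V : Type v} [Fintype V] [LinearOrder V] (A : PreAbstractSimplicialComplex V)
variable (D : Type u) [AddCommGroup D]

/-- The map is pullback along `topVertex`. Its inverse is of Čech type: `f` has a primitive `g u` on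
each closed star, and on the closed star of an edge two primitives differ by a constant, which
defines `c`. -/
theorem nonempty_orderedCohomology_equiv_small :
    Nonempty (OrderedCohomology A D ≃+ SmallCohomology (realization A) D) := by
  classical
  let φ : (V → V → D) →+ (realization A → realization A → D) :=
    { toFun := fun c x y => c (topVertex x) (topVertex y)
      map_zero' := rfl
      map_add' := fun _ _ => rfl }
  obtain ⟨η, hη, hηA⟩ : ∃ η > 0, ∀ x y : realization A, dist x y < η →
      topVertex x ∈ carrier y.1 := by
    by_cases h : Nonempty (realization A)
    · obtain ⟨x⟩ := h
      exact ⟨_, inv_card_pos x, fun x y => topVertex_mem_carrier⟩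
    · exact ⟨1, one_pos, fun x => absurd ⟨x⟩ h⟩
  have hηA' (x y : realization A) (h : dist x y < η) : topVertex y ∈ carrier x.1 :=
    hηA y x (by rwa [dist_comm])
  have hself (x : realization A) : topVertex x ∈ carrier x.1 := hηA x x (by rwa [dist_self])
  have hstar {u : V} {x : realization A} (h : u ∈ carrier x.1) : x ∈ closedStar A {u} := by
    have : {u} ∪ carrier x.1 = carrier x.1 :=
      Finset.union_eq_right.mpr (Finset.singleton_subset_iff.mpr h)
    change {u} ∪ carrier x.1 ∈ A
    rw [this]
    exact carrier_mem x
  refine nonempty_subquotient_equiv φ _ _ _ _ ?_ ?_ ?_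
  · intro c hc
    refine ⟨η, hη, fun x y z h1 h2 h3 => hc _ _ _ (face_mem (carrier_mem x) ?_ (by simp))⟩
    intro v hv
    simp only [Finset.mem_insert, Finset.mem_singleton] at hv
    rcases hv with rfl | rfl | rfl
    exacts [hself x, hηA' x y h1, hηA' x z h3]
  · intro c hc
    constructor
    · rintro ⟨g, ε, hε, hg⟩
      have hc0 {u : V} (hu : {u} ∈ A) : c u u = 0 := by
        have := hc u u u (by simpa using hu)
        simpa using this
      let e : V → D := fun u => if hu : {u} ∈ A then g ⟨_, single_mem_realization hu⟩ else 0
      refine ⟨e, fun u w huw => ?_⟩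
      have hu : {u} ∈ A := face_mem huw (by simp) (by simp)
      have hw : {w} ∈ A := face_mem huw (by simp) (by simp)
      have hmem : (⟨_, single_mem_realization hw⟩ : realization A) ∈ closedStar A {u} := by
        change {u} ∪ carrier (Pi.single w 1 : V → ℝ) ∈ A
        rwa [carrier_single]
      -- On the star of `u` both `g` and `c u ∘ topVertex` are primitives of the pulled-back
      -- cocycle, so they differ by a constant; comparing the vertices `w` and `u` gives `c u w`.
      have key := (isChainContractible_closedStar (Finset.mem_singleton_self u) hu).eq_of_locally_const
        (fun x => g x - c u (topVertex x)) (lt_min hε hη) (fun x hx y hy hxy => ?_) hmem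
      · rw [topVertex_single hw, topVertex_single hu, hc0 hu, sub_zero] at key
        simp only [e, dif_pos hu, dif_pos hw]
        rw [← key]
        abel
      · rw [lt_min_iff] at hxy
        have h1 : c (topVertex x) (topVertex y) = g y - g x := hg x y hxy.1
        have h2 : c u (topVertex x) + c (topVertex x) (topVertex y) = c u (topVertex y) := by
          refine hc _ _ _ (face_mem hx ?_ (by simp))
          intro v hv
          simp only [Finset.mem_insert, Finset.mem_singleton] at hv
          rw [Finset.mem_union, Finset.mem_singleton]
          rcases hv with rfl | rfl | rfl
          exacts [Or.inl rfl, Or.inr (hself x), Or.inr (hηA' x y hxy.2)]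
        rw [← h2, h1]
        abel
    · rintro ⟨g, hg⟩
      refine ⟨fun x => g (topVertex x), η, hη, fun x y h => hg _ _
        (face_mem (carrier_mem x) ?_ (by simp))⟩
      intro v hv
      simp only [Finset.mem_insert, Finset.mem_singleton] at hv
      rcases hv with rfl | rfl
      exacts [hself x, hηA' x y h]
  · rintro f ⟨ε, hε, hf⟩
    have hex (u : V) : ∃ g : realization A → D, {u} ∈ A → ∀ x ∈ closedStar A {u},
        ∀ y ∈ closedStar A {u}, dist x y < ε / 2 → f x y = g y - g x := by
      by_cases hu : {u} ∈ A
      · obtain ⟨g, -, hg⟩ := (isChainContractible_closedStar (Finset.mem_singleton_self u)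
          hu).exists_primitive f hε fun x _ y _ z _ => hf x y z
        exact ⟨g, fun _ => hg⟩
      · exact ⟨0, fun h => absurd h hu⟩
    choose g hg using hex
    have hsub {s t : Finset V} (hst : s ⊆ t) (hs : s.Nonempty) {x : realization A}
        (hx : x ∈ closedStar A t) : x ∈ closedStar A s :=
      face_mem hx (Finset.union_subset_union_left hst) (hs.mono Finset.subset_union_left)
    have hconst (u w : V) : ∃ a : D, ∀ x ∈ closedStar A {u, w}, g u x - g w x = a := by
      by_cases h : (closedStar A {u, w}).Nonempty
      · obtain ⟨x, hx⟩ := h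
        have hu : {u} ∈ A := face_mem hx (by simp [Finset.insert_union]) (by simp)
        have hw : {w} ∈ A := face_mem hx (by simp [Finset.insert_union]) (by simp)
        refine ⟨_, fun x hx => (isChainContractible_closedStar (Finset.mem_insert_self u {w})
          hu).eq_of_locally_const (fun x => g u x - g w x) (half_pos hε)
          (fun x hx y hy hxy => ?_) hx⟩
        have h1 := hg u hu x (hsub (by simp) (by simp) hx) y (hsub (by simp) (by simp) hy) hxy
        have h2 := hg w hw x (hsub (by simp) (by simp) hx) y (hsub (by simp) (by simp) hy) hxy
        rw [sub_eq_sub_iff_sub_eq_sub, ← neg_sub, ← h1, h2, neg_sub]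
      · exact ⟨0, fun x hx => absurd ⟨x, hx⟩ h⟩
    choose c hc using hconst
    -- The local primitives are glued by using at `x` the one for the star of its top vertex; the
    -- jumps between stars are exactly the values of `c`.
    refine ⟨c, fun u v w h => ?_, fun x => g (topVertex x) x, min (ε / 2) η,
      lt_min (half_pos hε) hη, fun x y hxy => ?_⟩
    · have hu : {u} ∈ A := face_mem h (by simp) (by simp)
      let x : realization A := ⟨_, single_mem_realization hu⟩
      have hx : x ∈ closedStar A {u, v, w} := by
        change {u, v, w} ∪ carrier (Pi.single u 1 : V → ℝ) ∈ A
        rwa [carrier_single, Finset.union_eq_left.mpr (by simp)]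
      rw [← hc u v x (hsub (by grind) (by simp) hx), ← hc v w x (hsub (by grind) (by simp) hx),
        ← hc u w x (hsub (by grind) (by simp) hx), sub_add_sub_cancel]
    · rw [lt_min_iff] at hxy
      have hu : {topVertex x} ∈ A :=
        face_mem (carrier_mem x) (Finset.singleton_subset_iff.mpr (hself x)) (by simp)
      have h1 := hg _ hu x (hstar (hself x)) y (hstar (hηA x y hxy.2)) hxy.1
      have h2 : y ∈ closedStar A {topVertex x, topVertex y} := by
        refine face_mem (carrier_mem y) (Finset.union_subset ?_ subset_rfl) (by simp)
        intro v hv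
        simp only [Finset.mem_insert, Finset.mem_singleton] at hv
        rcases hv with rfl | rfl
        exacts [hηA x y hxy.2, hself y]
      change f x y - c _ _ = _
      rw [h1, ← hc _ _ y h2]
      abel

end Comparison

/-! ### Alexander–Spanier H¹ of the torus by winding numbers -/

section Torus

theorem abs_clamp_sub_clamp_le (a b s t : ℝ) :
    |max (-a) (min a s) - max (-b) (min b t)| ≤ max |a - b| |s - t| := by
  refine (abs_max_sub_max_le_max _ _ _ _).trans (max_le ?_ ?_)
  · rw [neg_sub_neg, abs_sub_comm]
    exact le_max_left _ _
  · exact abs_min_sub_min_le_max _ _ _ _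

/-- Coordinates are clamped to growing intervals `[-kδ/2, kδ/2]`. Scaling in fixed steps would move
distant points too far, while clamping moves every point by at most `δ / 2`. -/
theorem isChainContractible_univ_pi (ι : Type*) [Fintype ι] :
    IsChainContractible (Set.univ : Set (ι → ℝ)) 0 := by
  intro δ hδ
  refine ⟨fun k x i => max (-(k * (δ / 2))) (min (k * (δ / 2)) (x i)), ?_, fun _ _ _ => trivial,
    ?_, ?_, ?_⟩
  · intro x _
    ext i
    simp
  · intro k x _ y _
    rw [dist_pi_le_iff dist_nonneg]
    intro i
    rw [Real.dist_eq]
    refine (abs_clamp_sub_clamp_le _ _ _ _).trans ?_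
    rw [sub_self, abs_zero, max_eq_right (abs_nonneg _), ← Real.dist_eq]
    exact dist_le_pi_dist x y i
  · intro k x _
    refine lt_of_le_of_lt ?_ (half_lt_self hδ)
    rw [dist_pi_le_iff (half_pos hδ).le]
    intro i
    rw [Real.dist_eq]
    refine (abs_clamp_sub_clamp_le _ _ _ _).trans ?_
    rw [sub_self, abs_zero, max_eq_left (abs_nonneg _)]
    push_cast
    rw [← sub_mul, sub_add_cancel_left, neg_one_mul, abs_neg, abs_of_pos (half_pos hδ)]
  · intro x _
    obtain ⟨N, hN⟩ := exists_nat_gt (‖x‖ / (δ / 2))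
    refine ⟨N, fun k hk => ?_⟩
    ext i
    have h1 : ‖x‖ ≤ k * (δ / 2) := by
      rw [← div_le_iff₀ (half_pos hδ)]
      exact hN.le.trans (by exact_mod_cast hk)
    have h2 := abs_le.mp ((norm_le_pi_norm x i).trans h1)
    change max _ (min _ (x i)) = x i
    rw [min_eq_right h2.2, max_eq_right h2.1]

/-- A section of the projection `ℝ → ℝ / ℤ`. -/
noncomputable def circleLift (p : UnitAddCircle) : ℝ := Quotient.out p

theorem coe_circleLift (p : UnitAddCircle) : (circleLift p : UnitAddCircle) = p := Quotient.out_eq p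

/-- The winding cocycle on the circle: the integer by which the chosen lifts of two close points
fail to be close. -/
noncomputable def winding (p q : UnitAddCircle) : ℤ := round (circleLift q - circleLift p)

theorem abs_circleLift_sub_winding (p q : UnitAddCircle) :
    |circleLift q - circleLift p - winding p q| = dist p q := by
  rw [winding, ← UnitAddCircle.norm_eq, AddCircle.coe_sub, coe_circleLift, coe_circleLift,
    dist_comm, dist_eq_norm]

/-- The differences of lifts telescope, so the defect is an integer of absolute value less than `3 ·
1/3`. -/
theorem winding_add_winding {p q r : UnitAddCircle} (h1 : dist p q < 1 / 3) (h2 : dist q r < 1 / 3)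
    (h3 : dist p r < 1 / 3) : winding p q + winding q r = winding p r := by
  rw [← abs_circleLift_sub_winding, abs_lt] at h1 h2 h3
  have h4 : ((winding p q + winding q r - winding p r : ℤ) : ℝ) < 1 := by
    push_cast; linarith
  have h5 : (-1 : ℝ) < (winding p q + winding q r - winding p r : ℤ) := by
    push_cast; linarith
  have h6 : winding p q + winding q r - winding p r < 1 := by exact_mod_cast h4
  have h7 : -1 < winding p q + winding q r - winding p r := by exact_mod_cast h5
  omega

/-- The sheet of the covering `ℝ → ℝ / ℤ`, relative to the chosen section. -/
noncomputable def sheet (x : ℝ) : ℤ := round (circleLift (x : UnitAddCircle) - x)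

theorem circleLift_coe (x : ℝ) : circleLift (x : UnitAddCircle) = x + sheet x := by
  have h : ((circleLift (x : UnitAddCircle) - x : ℝ) : UnitAddCircle) = 0 := by
    rw [AddCircle.coe_sub, coe_circleLift, sub_self]
  have h' := UnitAddCircle.norm_eq (x := circleLift (x : UnitAddCircle) - x)
  rw [h, norm_zero] at h'
  have := abs_eq_zero.mp h'.symm
  rw [sheet]
  linarith

theorem sheet_add_one (x : ℝ) : sheet (x + 1) = sheet x - 1 := by
  have h : ((x + 1 : ℝ) : UnitAddCircle) = x := by
    rw [AddCircle.coe_add, AddCircle.coe_period, add_zero]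
  have h1 := circleLift_coe (x + 1)
  rw [h, circleLift_coe] at h1
  have : (sheet (x + 1) : ℝ) = (sheet x - 1 : ℤ) := by push_cast; linarith
  exact_mod_cast this

/-- Pulled back to the line, the winding cocycle becomes the coboundary of `sheet`; below distance
`1/2` the difference `y - x` rounds to `0`. -/
theorem winding_coe {x y : ℝ} (h : |y - x| < 1 / 2) :
    winding (x : UnitAddCircle) (y : UnitAddCircle) = sheet y - sheet x := by
  have h0 : round (y - x) = 0 := by
    rw [round_eq_zero_iff]
    rw [abs_lt] at h
    constructor <;> linarith
  rw [winding, circleLift_coe, circleLift_coe,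
    show y + sheet y - (x + sheet x) = (y - x) + ((sheet y - sheet x : ℤ) : ℝ) by push_cast; ring,
    round_add_intCast, h0, zero_add]

variable {ι : Type*}

/-- The projection from Euclidean space to the torus. -/
def torusProj (x : ι → ℝ) : UnitAddTorus ι := fun i => (x i : UnitAddCircle)

theorem torusProj_add_single [DecidableEq ι] (x : ι → ℝ) (j : ι) :
    torusProj (x + Pi.single j 1) = torusProj x := by
  ext i
  by_cases h : i = j
  · subst h
    simp [torusProj]
  · simp [torusProj, h]

variable [Fintype ι]

theorem dist_torusProj_le (x y : ι → ℝ) : dist (torusProj x) (torusProj y) ≤ dist x y := by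
  rw [dist_pi_le_iff dist_nonneg]
  intro i
  refine le_trans ?_ (dist_le_pi_dist x y i)
  rw [dist_eq_norm, dist_eq_norm, torusProj, torusProj, ← AddCircle.coe_sub]
  exact QuotientAddGroup.norm_mk_le_norm

theorem periodic_intCast [DecidableEq ι] {α : Type*} {g : (ι → ℝ) → α}
    (hg : ∀ j, Function.Periodic g (Pi.single j 1)) (a : ι → ℤ) :
    Function.Periodic g (fun i => (a i : ℝ)) := by
  have h (s : Finset ι) : Function.Periodic g (∑ j ∈ s, a j • Pi.single j (1 : ℝ)) := by
    induction s using Finset.induction_on with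
    | empty => intro x; simp
    | insert j s hj ih =>
      rw [Finset.sum_insert hj]
      exact ((hg j).zsmul (a j)).add_period ih
  convert h Finset.univ using 1
  ext i
  simp [Finset.sum_apply, Pi.single_apply]

variable {D : Type*} [AddCommGroup D]

theorem sheet_sum_add_single [DecidableEq ι] (m : ι → D) (x : ι → ℝ) (j : ι) :
    ∑ i, sheet ((x + Pi.single j 1 : ι → ℝ) i) • m i = ∑ i, sheet (x i) • m i - m j := by
  rw [eq_sub_iff_add_eq, ← eq_sub_iff_add_eq', ← Finset.sum_sub_distrib,
    Finset.sum_eq_single j]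
  · simp [sheet_add_one, sub_smul]
  · intro i _ h
    simp [h]
  · simp

/-- The torus cocycle with prescribed periods. -/
noncomputable def torusCocycle : (ι → D) →+ (UnitAddTorus ι → UnitAddTorus ι → D) where
  toFun m p q := ∑ i, winding (p i) (q i) • m i
  map_zero' := by
    ext p q; simp
  map_add' m m' := by
    ext p q; simp [Finset.sum_add_distrib]

theorem torusCocycle_proj (m : ι → D) {x y : ι → ℝ} (h : dist x y < 1 / 2) :
    torusCocycle m (torusProj x) (torusProj y) =
      ∑ i, sheet (y i) • m i - ∑ i, sheet (x i) • m i := by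
  rw [← Finset.sum_sub_distrib]
  refine Finset.sum_congr rfl fun i _ => ?_
  rw [torusProj, torusProj, winding_coe, sub_smul]
  rw [← Real.dist_eq, dist_comm]
  exact (dist_le_pi_dist x y i).trans_lt h

variable (ι D) in
-- A class is determined by its periods: pulled back to Euclidean space a cocycle has a primitive,
-- whose increments under unit translations are constants, and these can be prescribed by
-- `torusCocycle`.
theorem nonempty_smallCohomology_torus_equiv :
    Nonempty (SmallCohomology (UnitAddTorus ι) D ≃+ (ι → D)) := by
  classical
  have hE := isChainContractible_univ_pi ι
  have key := nonempty_subquotient_equiv (torusCocycle (ι := ι) (D := D)) ⊤ ⊥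
    (smallCocycles (UnitAddTorus ι) D) (smallCoboundaries (UnitAddTorus ι) D) ?_ ?_ ?_
  · obtain ⟨e⟩ := key
    have h : (⊥ : AddSubgroup (ι → D)).addSubgroupOf ⊤ = ⊥ := by simp
    exact ⟨e.symm.trans (((QuotientAddGroup.quotientAddEquivOfEq h).trans
      QuotientAddGroup.quotientBot).trans AddSubgroup.topEquiv)⟩
  · intro m _
    refine ⟨1 / 3, by norm_num, fun p q r h1 h2 h3 => ?_⟩
    change ∑ i, _ + ∑ i, _ = ∑ i, _
    rw [← Finset.sum_add_distrib]
    refine Finset.sum_congr rfl fun i _ => ?_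
    rw [← add_smul, winding_add_winding ((dist_le_pi_dist p q i).trans_lt h1)
      ((dist_le_pi_dist q r i).trans_lt h2) ((dist_le_pi_dist p r i).trans_lt h3)]
  · intro m _
    constructor
    · rintro ⟨g, ε, hε, hg⟩
      -- Two primitives of the same cocycle on Euclidean space. Translation by the `j`-th unit
      -- vector changes the first by `-m j` and fixes the second, so `m j = 0`.
      have hconst : ∀ x : ι → ℝ, ∑ i, sheet (x i) • m i - g (torusProj x) =
          ∑ i, sheet ((0 : ι → ℝ) i) • m i - g (torusProj 0) := by
        intro x
        refine hE.eq_of_locally_const (fun x : ι → ℝ => ∑ i, sheet (x i) • m i - g (torusProj x))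
          (lt_min hε (by norm_num : (0 : ℝ) < 1 / 2)) (fun x _ y _ hxy => ?_) (Set.mem_univ x)
        rw [lt_min_iff] at hxy
        have h1 := hg _ _ ((dist_torusProj_le x y).trans_lt hxy.1)
        rw [torusCocycle_proj m hxy.2] at h1
        rw [sub_eq_sub_iff_sub_eq_sub, ← neg_sub, h1, neg_sub]
      rw [AddSubgroup.mem_bot]
      ext j
      have h1 := hconst (0 + Pi.single j (1 : ℝ))
      rw [sheet_sum_add_single, torusProj_add_single] at h1
      simpa using h1
    · intro hm
      rw [AddSubgroup.mem_bot.mp hm, map_zero]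
      exact AddSubgroup.zero_mem _
  · rintro f ⟨ε, hε, hf⟩
    obtain ⟨g, -, hg⟩ := hE.exists_primitive (fun x y => f (torusProj x) (torusProj y)) hε
      fun x _ y _ z _ h1 h2 h3 => hf _ _ _ ((dist_torusProj_le x y).trans_lt h1)
        ((dist_torusProj_le y z).trans_lt h2) ((dist_torusProj_le x z).trans_lt h3)
    have hper (j : ι) (x : ι → ℝ) : g (x + Pi.single j 1) - g x =
        g (0 + Pi.single j 1) - g 0 := by
      refine hE.eq_of_locally_const (fun x => g (x + Pi.single j 1) - g x)
        (half_pos hε) (fun x _ y _ hxy => ?_) (Set.mem_univ x)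
      have h1 := hg x trivial y trivial hxy
      have h2 := hg (x + Pi.single j 1) trivial (y + Pi.single j 1) trivial (by simpa using hxy)
      simp only [torusProj_add_single] at h2
      rw [sub_eq_sub_iff_sub_eq_sub, ← neg_sub, ← h2, h1, neg_sub]
    -- The sign is forced by `sheet` dropping by one under a unit translation; it makes `g'`
    -- periodic.
    let m : ι → D := fun j => -(g (0 + Pi.single j 1) - g 0)
    let g' : (ι → ℝ) → D := fun x => g x - ∑ i, sheet (x i) • m i
    have hg'per (j : ι) : Function.Periodic g' (Pi.single j 1) := by
      intro x
      simp only [g']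
      rw [sheet_sum_add_single]
      simp only [m]
      rw [← hper j x]
      abel
    have hg'proj (x : ι → ℝ) : g' (fun i => circleLift (torusProj x i)) = g' x := by
      rw [← periodic_intCast hg'per (fun i => sheet (x i)) x]
      congr 1
      ext i
      exact circleLift_coe (x i)
    refine ⟨m, trivial, fun p => g' fun i => circleLift (p i), min (ε / 2) (1 / 2),
      lt_min (half_pos hε) (by norm_num), fun p q hpq => ?_⟩
    let x : ι → ℝ := fun i => circleLift (p i)
    -- The lift of `q` nearest to `x`: chosen lifts of close points may lie on different sheets, and
    -- `winding` corrects this.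
    let y : ι → ℝ := fun i => circleLift (q i) - winding (p i) (q i)
    have hx : torusProj x = p := by
      ext i
      exact coe_circleLift (p i)
    have hy : torusProj y = q := by
      ext i
      have h0 : ((winding (p i) (q i) : ℝ) : UnitAddCircle) = 0 := by
        rw [AddCircle.coe_eq_zero_iff]
        exact ⟨winding (p i) (q i), by simp⟩
      change ((circleLift (q i) - winding (p i) (q i) : ℝ) : UnitAddCircle) = q i
      rw [AddCircle.coe_sub, h0, sub_zero, coe_circleLift]
    have hxy : dist x y ≤ dist p q := by
      rw [dist_pi_le_iff dist_nonneg]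
      intro i
      refine le_trans (le_of_eq ?_) (dist_le_pi_dist p q i)
      rw [← abs_circleLift_sub_winding, dist_comm, Real.dist_eq]
      congr 1
      simp only [x, y]
      ring
    have h := hxy.trans_lt hpq
    rw [lt_min_iff] at h
    have h1 := hg x trivial y trivial h.1
    have h2 := torusCocycle_proj m h.2
    have h3 := hg'proj x
    have h4 := hg'proj y
    rw [hx] at h1 h2 h3
    rw [hy] at h1 h2 h4
    simp only [h3, h4]
    change f p q - torusCocycle m p q = _
    rw [h1, h2]
    simp only [g']
    abel

end Torus

/-! ### Consequences for a region homeomorphic to a torus -/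

section Torus

variable {V : Type v} [Fintype V] [LinearOrder V] {A : PreAbstractSimplicialComplex V}
variable {ι : Type*} [Fintype ι]

/-- Working with arbitrary coefficients `D` avoids any separate proof that `H₁` is torsion free. -/
theorem nonempty_homology_one_dual_equiv_of_torus (e : realization A ≃ₜ UnitAddTorus ι)
    (D : Type u) [AddCommGroup D] :
    Nonempty (((chains A).homology 1 →+ D) ≃+ (ι → D)) := by
  have : CompactSpace (realization A) := e.symm.compactSpace
  obtain ⟨e1⟩ := nonempty_cohomology_chains_equiv A D 1 le_rfl
  obtain ⟨e2⟩ := nonempty_cohomology_one_equiv_ordered A D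
  obtain ⟨e3⟩ := nonempty_orderedCohomology_equiv_small A D
  obtain ⟨e4⟩ := nonempty_smallCohomology_equiv D e.toEquiv
    (CompactSpace.uniformContinuous_of_continuous e.continuous)
    (CompactSpace.uniformContinuous_of_continuous e.symm.continuous)
  obtain ⟨e5⟩ := nonempty_smallCohomology_torus_equiv ι D
  exact ⟨e1.symm.trans (e2.trans (e3.trans (e4.symm.trans e5)))⟩

theorem betti_one_of_torus (e : realization A ≃ₜ UnitAddTorus ι) :
    betti (chains A) 1 = Fintype.card ι := by
  obtain ⟨e'⟩ := nonempty_homology_one_dual_equiv_of_torus e ℚ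
  let e'' : ((chains A).homology 1 →+ ℚ) ≃ₗ[ℚ] (ι → ℚ) :=
    { e' with map_smul' := fun c x => map_rat_smul e'.toAddMonoidHom c x }
  rw [betti, ← finrank_addMonoidHom_rat, e''.finrank_eq, Module.finrank_fintype_fun_eq_card]

theorem card_homology_one_dual_of_torus (e : realization A ≃ₜ UnitAddTorus ι)
    (D : Type u) [AddCommGroup D] :
    Nat.card ((chains A).homology 1 →+ D) = Nat.card D ^ Fintype.card ι := by
  obtain ⟨e'⟩ := nonempty_homology_one_dual_equiv_of_torus e D
  rw [Nat.card_congr e'.toEquiv, Nat.card_fun, Nat.card_eq_fintype_card (α := ι)]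

end Torus

/-! ### Evaluation of the area and topological terms -/

section Entropy

theorem log_card_of_subsingleton (α : Type*) [Subsingleton α] : Real.log (Nat.card α) = 0 := by
  have h : Nat.card α ≤ 1 := Finite.card_le_one_iff_subsingleton.mpr inferInstance
  interval_cases Nat.card α <;> simp

/-- Only the term `n = 0`, `p = 1` of the double sum contributes. -/
theorem sum_range_sum_Icc_eq_of_add_ne_one (d : ℕ) (f : ℕ → ℕ → ℝ)
    (hf : ∀ n p, n + p ≠ 1 → f n p = 0) (hd : d = 0 → f 0 1 = 0) :
    ∑ n ∈ Finset.range d, ∑ p ∈ Finset.Icc 1 d, f n p = f 0 1 := by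
  -- For `d = 0` the double sum is empty, so `f 0 1` itself has to vanish.
  rcases Nat.eq_zero_or_pos d with rfl | hpos
  · simp [hd rfl]
  · rw [Finset.sum_eq_single_of_mem 0 (Finset.mem_range.mpr hpos),
      Finset.sum_eq_single_of_mem 1 (Finset.mem_Icc.mpr ⟨le_rfl, hpos⟩)]
    · exact fun p _ hp => hf 0 p (by omega)
    · refine fun n _ hn => Finset.sum_eq_zero fun p hp => hf n p ?_
      have := (Finset.mem_Icc.mp hp).1
      omega

variable {V : Type v}

theorem isEmpty_simplices_of_card_le {K : PreAbstractSimplicialComplex V} {d n : ℕ}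
    (hK : ∀ s ∈ K, s.card ≤ d + 1) (h : d < n) : IsEmpty (Simplices K n) :=
  ⟨fun s => by
    have := hK s.1 s.2.1
    have := s.2.2
    omega⟩

/-- Among single vertices, a face of a simplex is that simplex, so it cannot lie in `A` while the
simplex does not. This settles `d = 0`. -/
theorem isEmpty_simplices_entanglingSurface {K A : PreAbstractSimplicialComplex V}
    (hK : ∀ s ∈ K, s.card ≤ 0 + 1) (n : ℕ) : IsEmpty (Simplices (entanglingSurface K A) n) :=
  ⟨fun ⟨s, ⟨hsA, t, ht, htA, hst⟩, hc⟩ => by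
    have h1 := hK t ht
    have : s = t := Finset.eq_of_subset_of_card_le hst (by omega)
    exact htA (this ▸ hsA)⟩

theorem areaTerm_oneGauge (d : ℕ) (K A : PreAbstractSimplicialComplex V)
    (hK : ∀ s ∈ K, s.card ≤ d + 1) (G : ChainComplex AddCommGrpCat.{u} ℕ)
    (hG : ∀ n, n ≠ 1 → Subsingleton (G.X n)) :
    areaTerm d K A G =
      (Nat.card (Simplices (entanglingSurface K A) 0) : ℝ) * Real.log (Nat.card (G.X 1)) := by
  unfold areaTerm
  rw [sum_range_sum_Icc_eq_of_add_ne_one]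
  · norm_num
  · intro n p h
    have := hG _ h
    rw [log_card_of_subsingleton, mul_zero]
  · rintro rfl
    have := isEmpty_simplices_entanglingSurface (A := A) hK 0
    simp

variable [LinearOrder V]

theorem subsingleton_cohomology (C : ChainComplex AddCommGrpCat.{v} ℕ) (D : Type u)
    [AddCommGroup D] [Subsingleton D] (n : ℕ) : Subsingleton (Cohomology C D n) := by
  have : Subsingleton (cocycles C D n) :=
    ⟨fun f g => Subtype.ext (AddMonoidHom.ext fun x => Subsingleton.elim _ _)⟩
  exact (QuotientAddGroup.mk_surjective).subsingleton

theorem subsingleton_homology_chains {K : PreAbstractSimplicialComplex V} {n : ℕ}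
    (h : IsEmpty (Simplices K n)) : Subsingleton ((chains K).homology n) := by
  have : Subsingleton ((chains K).X n) :=
    inferInstanceAs (Subsingleton (Simplices K n →₀ ℤ))
  exact subsingleton_homology _ n

theorem topologicalTerm_oneGauge [Finite V] (d : ℕ) (K A : PreAbstractSimplicialComplex V)
    (hK : ∀ s ∈ K, s.card ≤ d + 1) (hA : A ≤ K) (G : ChainComplex AddCommGrpCat.{u} ℕ)
    (hG : ∀ n, n ≠ 1 → Subsingleton (G.X n)) :
    topologicalTerm d K A G =
      Real.log (Nat.card ((chains A).homology 1 →+ G.X 1))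
        - (betti (chains (entanglingSurface K A)) 0 : ℝ) * Real.log (Nat.card (G.X 1)) := by
  have hH (n : ℕ) (hn : n ≠ 1) : Subsingleton (G.homology n) := by
    have := hG n hn
    exact subsingleton_homology G n
  obtain ⟨eG⟩ := nonempty_homology_one_equiv G (hG 0 (by omega)) (hG 2 (by omega))
  have hsurface : (Nat.card (Cohomology (chains (entanglingSurface K A)) (G.homology 1) 0) : ℝ) =
      (Nat.card (G.X 1) : ℝ) ^ betti (chains (entanglingSurface K A)) 0 := by
    obtain ⟨e⟩ := nonempty_cohomology_chains_equiv (entanglingSurface K A) (G.homology 1) 0 zero_le_one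
    obtain ⟨_, _⟩ := free_and_finite_homology_zero (entanglingSurface K A)
    rw [Nat.card_congr e.toEquiv, card_addMonoidHom_of_free, Nat.card_congr eG.toEquiv, betti]
    push_cast
    rfl
  unfold topologicalTerm
  rw [sum_range_sum_Icc_eq_of_add_ne_one, sub_eq_add_neg]
  · congr 1
    -- For `d = 0` the index `n = 1` is out of range, but then `A` has no edges and `Hom(H₁, G₁)` is
    -- trivial.
    · rcases Nat.eq_zero_or_pos d with rfl | hpos
      · have h1 := subsingleton_homology_chains (K := A)
          (isEmpty_simplices_of_card_le (fun s hs => hK s (hA hs)) zero_lt_one)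
        have h2 : Subsingleton ((chains A).homology 1 →+ G.X 1) :=
          ⟨fun f g => AddMonoidHom.ext fun x => by rw [Subsingleton.elim x 0, map_zero, map_zero]⟩
        have h3 := hH 0 zero_ne_one
        have h4 := subsingleton_cohomology (chains A) (G.homology 0) 0
        rw [Finset.sum_range_one, log_card_of_subsingleton, log_card_of_subsingleton]
      · rw [Finset.sum_eq_single_of_mem 1 (Finset.mem_range.mpr (by omega))]
        · obtain ⟨e⟩ := nonempty_cohomology_chains_equiv A (G.homology 1) 1 le_rfl
          rw [Nat.card_congr (e.trans eG.addMonoidHomCongrRight).toEquiv]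
        · intro n _ hn
          have h3 := hH n hn
          have h4 := subsingleton_cohomology (chains A) (G.homology n) n
          exact log_card_of_subsingleton _
    · rw [pow_one, neg_one_mul, ← Real.log_pow, ← hsurface]
  · intro n p h
    have h3 := hH _ h
    have h4 := subsingleton_cohomology (chains (entanglingSurface K A)) (G.homology (n + p)) n
    rw [log_card_of_subsingleton, mul_zero]
  · rintro rfl
    have h1 := subsingleton_homology_chains (isEmpty_simplices_entanglingSurface (A := A) hK 0)
    have h2 : betti (chains (entanglingSurface K A)) 0 = 0 :=
      Module.finrank_zero_of_subsingleton
    rw [h2, pow_zero] at hsurface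
    change (-1) ^ 1 * Real.log (Nat.card
      (Cohomology (chains (entanglingSurface K A)) (G.homology 1) 0)) = 0
    rw [hsurface, Real.log_one, mul_zero]

end Entropy

end GaugeEntropy

theorem mainTheorem4 {V : Type v} [Fintype V] [LinearOrder V] (d : ℕ)
    (K A : PreAbstractSimplicialComplex V)
    (hK : ∀ s ∈ K, s.card ≤ d + 1) (hA : A ≤ K)
    (G : ChainComplex AddCommGrpCat.{u} ℕ) [Finite (G.X 1)]
    (hG : ∀ n, n ≠ 1 → Subsingleton (G.X n)) :
    GaugeEntropy.areaTerm d K A G =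
        (Nat.card (GaugeEntropy.Simplices (GaugeEntropy.entanglingSurface K A) 0) : ℝ)
          * Real.log (Nat.card (G.X 1)) ∧
      GaugeEntropy.topologicalTerm d K A G =
        Real.log (Nat.card ((GaugeEntropy.chains A).homology 1 →+ G.X 1))
          - (GaugeEntropy.betti (GaugeEntropy.chains (GaugeEntropy.entanglingSurface K A)) 0 : ℝ)
            * Real.log (Nat.card (G.X 1)) ∧
      (Nonempty (GaugeEntropy.realization A ≃ₜ UnitAddTorus (Fin d)) →
        GaugeEntropy.betti (GaugeEntropy.chains A) 1 = d ∧
        GaugeEntropy.topologicalTerm d K A G =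
          ((GaugeEntropy.betti (GaugeEntropy.chains A) 1 : ℝ)
            - (GaugeEntropy.betti (GaugeEntropy.chains (GaugeEntropy.entanglingSurface K A)) 0 : ℝ))
            * Real.log (Nat.card (G.X 1))) := by
  have htop := GaugeEntropy.topologicalTerm_oneGauge d K A hK hA G hG
  refine ⟨GaugeEntropy.areaTerm_oneGauge d K A hK G hG, htop, fun ⟨e⟩ => ?_⟩
  have hb : GaugeEntropy.betti (GaugeEntropy.chains A) 1 = d := by
    rw [GaugeEntropy.betti_one_of_torus e, Fintype.card_fin]
  refine ⟨hb, ?_⟩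
  rw [htop, GaugeEntropy.card_homology_one_dual_of_torus e, Fintype.card_fin, hb, Nat.cast_pow,
    Real.log_pow, sub_mul]
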